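/- Let $\mathcal A$ be a von Neumann algebra with norm separable predual and a faithful normal tracial state $\tau$. Let $L^2(\mathcal A,\tau)$ be the completion of $\mathcal A$ in the norm $\|a\|_2=\tau(a^*a)^{1/2}$; for a von Neumann subalgebra $\mathcal B$, $L^2(\mathcal B,\tau)$ is the closure of $\mathcal B$ in it, and products of elements of $L^2(\mathcal A,\tau)$ are taken in $L^1(\mathcal A,\tau)\cong\mathcal A_*$. Let $(\mathcal A,\tau,S;(\mathcal A_I)_I)$ be an $\mathcal A_0$-valued white noise. This means: $(\mathcal A_I)_I$ is a family of von Neumann subalgebras indexed by the intervals $I=[s,t]$, $-\infty\le s\le t\le\infty$, such that $\mathcal A_I$ and $\mathcal A_J$ generate $\mathcal A_K$ whenever $I\cup J=K$, and $\mathcal A_{[-\infty,\infty]}=\mathcal A$; $S=(S_t)_{t\in\mathbb R}$ is a pointwise weak* continuous group of $\tau$-preserving $*$-automorphisms of $\mathcal A$ with $S_t(\mathcal A_{[r,s]})=\mathcal A_{[r+t,s+t]}$; the fixed point algebra of $S$ is a von Neumann subalgebra $\mathcal A_0$ contained in all $\mathcal A_I$; and $E_I\circ E_J=E_0$ whenever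 the interiors of $I$ and $J$ are disjoint (where $[s,s]$ has empty interior). Here $E_I$ and $E_0$ denote the $\tau$-preserving conditional expectations onto $\mathcal A_I$ and $\mathcal A_0$ and their extensions to $L^p(\mathcal A,\tau)$; also $S_t$ denotes its extension to $L^2(\mathcal A,\tau)$. Let $b=(b_t)_{t\ge0}$ be an additive $L^2$-cocycle for $S$, that is, a norm continuous family in $L^2(\mathcal A,\tau)$ with $b_t\in L^2(\mathcal A_{[0,t]},\tau)$ and $b_{s+t}=S_t(b_s)+b_t$ for all $s,t\ge0$; $b$ need not be centred. Suppose that its covariance $E_0(b_1^*b_1)\in L^1(\mathcal A_0,\tau)$ belongs to $L^\infty(\mathcal A_0,\tau)=\mathcal A_0$. For $T\ge0$ let $\mathcal H([0,T])$ be the Hilbert space of (classes of) square integrable functions $y:[0,T]\to L^2(\mathcal A,\tau)$ that are adapted, i.e. $y_s\in L^2(\mathcal A_{[0,s]},\tau)$ for almost every $s$. Put $c_t=b_t-E_0(b_t)$ and $d=E_0(b_1)$, so that $b_t=c_t+td$. For a simple adapted process $y=\sum_{j=0}^{n-1}y_{s_j}\chi_{[s_j,s_{j+1})}$, where $0=s_0<\dots<s_n=t$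 and $y_{s_j}\in L^2(\mathcal A_{[0,s_j]},\tau)$, put $\int_0^t dc_s\,y_s=\sum_{j}(c_{s_{j+1}}-c_{s_j})y_{s_j}$. Extend this by continuity to $\mathcal H([0,t])$, and put $\int_0^t db_s\,y_s=\int_0^t dc_s\,y_s+\int_0^t d\,y_s\,ds$. **Theorem.** For every $T\ge0$ there is exactly one $y\in\mathcal H([0,T])$ such that $$y_t=1+\int_0^t db_s\,y_s\qquad\text{for almost every }t\in[0,T].$$ -/

import Mathlib

open MeasureTheory Filter Topology
open scoped ComplexOrder InnerProductSpace ENNReal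

noncomputable section

namespace NCWhiteNoise

/-! ## Noncommutative probability spaces

A von Neumann algebra is a C⋆-algebra `A` with a Banach space predual `X`, given through an isometric
isomorphism `e` from the dual of `X` onto `A` (Sakai's definition). -/

section Algebra

variable {A X : Type*} [CStarAlgebra A] [NormedAddCommGroup X] [NormedSpace ℂ X]

/-- The weak* topology `σ(A, X)`. -/
abbrev weakStar (e : StrongDual ℂ X ≃ₗᵢ[ℂ] A) : TopologicalSpace A :=
  TopologicalSpace.induced (fun (a : A) (ξ : X) => e.symm a ξ) inferInstance

/-- A (unital) von Neumann subalgebra: a weak*-closed unital *-subalgebra. -/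
def IsVNSubalgebra (e : StrongDual ℂ X ≃ₗᵢ[ℂ] A) (N : StarSubalgebra ℂ A) : Prop :=
  IsClosed[weakStar e] (N : Set A)

/-- `N` is the von Neumann subalgebra generated by the set `B`. -/
def IsGeneratedBy (e : StrongDual ℂ X ≃ₗᵢ[ℂ] A) (B : Set A) (N : StarSubalgebra ℂ A) : Prop :=
  IsLeast {M : StarSubalgebra ℂ A | IsVNSubalgebra e M ∧ B ⊆ M} N

variable [PartialOrder A] [StarOrderedRing A]

/-- A faithful normal tracial state on the von Neumann algebra `A`. -/
structure TracialState (e : StrongDual ℂ X ≃ₗᵢ[ℂ] A) extends A →ₚ[ℂ] ℂ where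
  map_one : toFun 1 = 1
  tracial : ∀ a b : A, toFun (a * b) = toFun (b * a)
  faithful : ∀ a : A, toFun (star a * a) = 0 → a = 0
  normal : @Continuous A ℂ (weakStar e) inferInstance toFun

end Algebra

variable {A X : Type*} [CStarAlgebra A] [PartialOrder A] [StarOrderedRing A]
  [NormedAddCommGroup X] [NormedSpace ℂ X] {e : StrongDual ℂ X ≃ₗᵢ[ℂ] A}

/-! ## The Hilbert space `L²(A, τ)` -/

/-- `L²(A, τ)`, the completion of `A` for the norm `‖a‖₂ = τ(a* a)^{1/2}`, with
inner product `⟪a, b⟫ = τ(a* b)`. -/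
abbrev L2 (τ : TracialState e) : Type _ := τ.toPositiveLinearMap.GNS

/-- The canonical embedding of `A = L^∞(A, τ)` into `L²(A, τ)`. -/
def toL2 (τ : TracialState e) (a : A) : L2 τ :=
  ((τ.toPositiveLinearMap.toPreGNS a : τ.toPositiveLinearMap.PreGNS) : L2 τ)

/-- Left multiplication by `a ∈ A` on `L²(A, τ)`. -/
def leftMul (τ : TracialState e) (a : A) : L2 τ →L[ℂ] L2 τ :=
  τ.toPositiveLinearMap.gnsStarAlgHom a

/-- The adjoint `x ↦ x*` on `L²(A, τ)`: the extension by continuity of `star` on `A`, which is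
isometric for `‖·‖₂` because `τ` is a trace. -/
def adj (τ : TracialState e) : L2 τ → L2 τ :=
  UniformSpace.Completion.map fun a =>
    τ.toPositiveLinearMap.toPreGNS (star (τ.toPositiveLinearMap.ofPreGNS a))

theorem adj_toL2 (τ : TracialState e) (a : A) : adj τ (toL2 τ a) = toL2 τ (star a) := by
  refine UniformSpace.Completion.map_coe (Isometry.uniformContinuous ?_) _
  refine Isometry.of_dist_eq fun x y => ?_
  rw [dist_eq_norm, dist_eq_norm, ← map_sub, ← star_sub, ← map_sub,
    PositiveLinearMap.preGNS_norm_def, PositiveLinearMap.preGNS_norm_def]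
  simp only [PositiveLinearMap.ofPreGNS_toPreGNS, star_star]
  exact congrArg (fun z : ℂ => √z.re) (τ.tracial _ _)

/-- `x y = z` for `x, y, z ∈ L²(A, τ)`. The product `x y` lies in `L¹(A, τ)`, which is the predual of
`A` through `w ↦ (a ↦ τ(a w))`; so the equation says `τ((a* x) y) = τ(a* z)` for all `a ∈ A`. -/
def IsMul (τ : TracialState e) (x y z : L2 τ) : Prop :=
  ∀ a : A, ⟪adj τ (leftMul τ (star a) x), y⟫_ℂ = ⟪toL2 τ a, z⟫_ℂ

/-- `L²(N, τ)` as a closed subspace of `L²(A, τ)`: the closure of `N`. -/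
def L2Sub (τ : TracialState e) (N : StarSubalgebra ℂ A) : Submodule ℂ (L2 τ) :=
  (Submodule.span ℂ (toL2 τ '' (N : Set A))).topologicalClosure

instance (τ : TracialState e) (N : StarSubalgebra ℂ A) : CompleteSpace (L2Sub τ N) :=
  (Submodule.isClosed_topologicalClosure _).completeSpace_coe

/-- The trace preserving conditional expectation onto `N`, extended to `L²(A, τ)`: since
`τ(E_N(x) a) = τ(x a)` for `a ∈ N`, it is the orthogonal projection onto `L²(N, τ)`. -/
def traceCondExp (τ : TracialState e) (N : StarSubalgebra ℂ A) : L2 τ →L[ℂ] L2 τ :=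
  (L2Sub τ N).starProjection

/-- `k ∈ N` is the conditional expectation `E_N(x* x)` of `x* x ∈ L¹(A, τ)`, where `x ∈ L²(A, τ)`;
that is, `E_N(x* x)` lies in `L^∞(N, τ)` and equals `k`. The conditional expectation is determined by
`τ(x* x a) = τ(k a)` for `a ∈ N`, and `τ(x* x a) = τ(x a x*) = ⟪x*, a x*⟫`. -/
def IsCondExpAbsSq (τ : TracialState e) (N : StarSubalgebra ℂ A) (x : L2 τ) (k : A) : Prop :=
  k ∈ N ∧ ∀ a ∈ N, ⟪adj τ x, leftMul τ a (adj τ x)⟫_ℂ = τ.toPositiveLinearMap (k * a)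

/-- An automorphism of the probability space `(A, τ)`: a trace preserving *-automorphism. -/
structure ProbAut (τ : TracialState e) where
  toEquiv : A ≃⋆ₐ[ℂ] A
  trace_map : ∀ a : A, τ.toPositiveLinearMap (toEquiv a) = τ.toPositiveLinearMap a

/-- An automorphism of `(A, τ)` as an isometry of `A` with the norm `‖·‖₂`. -/
def ProbAut.preL2 {τ : TracialState e} (S : ProbAut τ) :
    τ.toPositiveLinearMap.PreGNS →ₗᵢ[ℂ] τ.toPositiveLinearMap.PreGNS where
  toFun a := τ.toPositiveLinearMap.toPreGNS (S.toEquiv (τ.toPositiveLinearMap.ofPreGNS a))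
  map_add' a b := by simp
  map_smul' c a := by simp
  norm_map' a := by
    simp only [PositiveLinearMap.preGNS_norm_def, LinearMap.coe_mk, AddHom.coe_mk,
      PositiveLinearMap.ofPreGNS_toPreGNS]
    rw [← map_star, ← map_mul, S.trace_map]

/-- The extension of an automorphism of `(A, τ)` to `L²(A, τ)`. -/
def ProbAut.onL2 {τ : TracialState e} (S : ProbAut τ) : L2 τ →L[ℂ] L2 τ :=
  S.preL2.toContinuousLinearMap.completion

/-! ## White noises -/

/-- An operator-valued white noise `(A, τ, S; (A_I))` over `A₀`. The algebra of the interval `I = [s, t]`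
is `alg s t`, where `-∞ ≤ s ≤ t ≤ ∞` (the values for `t < s` play no role). -/
structure WhiteNoise (τ : TracialState e) where
  /-- the shift -/
  shift : ℝ → ProbAut τ
  shift_zero : ∀ a, (shift 0).toEquiv a = a
  shift_add : ∀ s t a, (shift (s + t)).toEquiv a = (shift s).toEquiv ((shift t).toEquiv a)
  shift_continuous : ∀ a, @Continuous ℝ A inferInstance (weakStar e) fun t => (shift t).toEquiv a
  /-- the filtration -/
  alg : EReal → EReal → StarSubalgebra ℂ A
  isVN_alg : ∀ s t, s ≤ t → IsVNSubalgebra e (alg s t)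
  /-- `A_I` and `A_J` generate `A_K` whenever `I ∪ J = K` -/
  alg_union : ∀ s t s' t' p q, s ≤ t → s' ≤ t' → p ≤ q →
    Set.Icc s t ∪ Set.Icc s' t' = Set.Icc p q →
      IsGeneratedBy e ((alg s t : Set A) ∪ (alg s' t' : Set A)) (alg p q)
  minimal : alg ⊥ ⊤ = ⊤
  compatible : ∀ (s t : EReal) (r : ℝ), s ≤ t →
    (shift r).toEquiv '' (alg s t : Set A) = (alg (s + r) (t + r) : Set A)
  /-- the algebra `A₀` -/
  alg₀ : StarSubalgebra ℂ A
  isVN_alg₀ : IsVNSubalgebra e alg₀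
  alg₀_le : ∀ s t, s ≤ t → alg₀ ≤ alg s t
  /-- `A₀` is the fixed point algebra of the shift -/
  mem_alg₀_iff : ∀ a, a ∈ alg₀ ↔ ∀ t, (shift t).toEquiv a = a
  /-- `E_I ∘ E_J = E_0` whenever the interiors of `I` and `J` are disjoint -/
  independent : ∀ s t s' t', s ≤ t → s' ≤ t' → Disjoint (Set.Ioo s t) (Set.Ioo s' t') →
    traceCondExp τ (alg s t) ∘L traceCondExp τ (alg s' t') = traceCondExp τ alg₀

namespace WhiteNoise

variable {τ : TracialState e} (W : WhiteNoise τ)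

/-- `L²(A_{[0,t]}, τ)` for `t ≥ 0`. -/
def adaptedSpace (t : ℝ) : Submodule ℂ (L2 τ) := L2Sub τ (W.alg 0 (t : EReal))

/-- The conditional expectation `E_0` on `L²(A, τ)`. -/
def E₀ : L2 τ →L[ℂ] L2 τ := traceCondExp τ W.alg₀

/-- `(b_t)_{t ≥ 0}` is an additive `L²`-cocycle for the shift (only the values at `t ≥ 0` matter). -/
structure IsAdditiveCocycle (b : ℝ → L2 τ) : Prop where
  continuousOn : ContinuousOn b (Set.Ici 0)
  adapted : ∀ t, 0 ≤ t → b t ∈ W.adaptedSpace t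
  cocycle : ∀ s t, 0 ≤ s → 0 ≤ t → b (s + t) = (W.shift t).onL2 (b s) + b t

/-- The covariance `E_0(b_1* b_1)` lies in `L^∞(A₀, τ)`. -/
def HasBoundedCovariance (b : ℝ → L2 τ) : Prop :=
  ∃ k : A, IsCondExpAbsSq τ W.alg₀ (b 1) k

/-- The centred part `c_t = b_t - E_0(b_t)` of a cocycle. -/
def centredPart (b : ℝ → L2 τ) (t : ℝ) : L2 τ := b t - W.E₀ (b t)

/-- The drift coefficient `d = E_0(b_1)`, for which `E_0(b_t) = t d` and so `b_t = c_t + t d`. -/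
def driftCoeff (b : ℝ → L2 τ) : L2 τ := W.E₀ (b 1)

/-! ## The Itô integral -/

/-- Simple adapted processes `∑_j y_j χ_{[s_j, s_{j+1})}` on `[0, T]`, where
`0 = s_0 < s_1 < ⋯ < s_n = T` and `y_j ∈ L²(A_{[0, s_j]}, τ)`. -/
structure SimpleAdapted (T : ℝ) where
  n : ℕ
  node : ℕ → ℝ
  node_zero : node 0 = 0
  node_last : node n = T
  node_lt : ∀ j < n, node j < node (j + 1)
  value : ℕ → L2 τ
  value_mem : ∀ j < n, value j ∈ W.adaptedSpace (node j)

variable {W} in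
/-- The function `ℝ → L²(A, τ)` given by a simple process. -/
def SimpleAdapted.toFun {T : ℝ} (P : W.SimpleAdapted T) (r : ℝ) : L2 τ :=
  ∑ j ∈ Finset.range P.n,
    (Set.Ico (P.node j) (P.node (j + 1))).indicator (fun _ => P.value j) r

variable {W} in
/-- `I = ∑_j (c_{s_{j+1}} - c_{s_j}) y_j`, where all the products lie in `L²(A, τ)`. -/
def SimpleAdapted.HasIntegral {T : ℝ} (P : W.SimpleAdapted T) (c : ℝ → L2 τ) (I : L2 τ) : Prop :=
  ∃ z : ℕ → L2 τ,
    (∀ j < P.n, IsMul τ (c (P.node (j + 1)) - c (P.node j)) (P.value j) (z j)) ∧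
      I = ∑ j ∈ Finset.range P.n, z j

/-- `I = ∫_0^t dc_s y_s`, the left Itô integral for a centred cocycle `c`: the extension by continuity
from simple adapted processes, with respect to the `L²([0, t]; L²(A, τ))` norm. -/
def HasItoIntegral (c : ℝ → L2 τ) (t : ℝ) (y : ℝ → L2 τ) (I : L2 τ) : Prop :=
  ∃ (P : ℕ → W.SimpleAdapted t) (J : ℕ → L2 τ),
    (∀ m, (P m).HasIntegral c (J m)) ∧
    Tendsto (fun m => eLpNorm (fun r => (P m).toFun r - y r) 2 (volume.restrict (Set.Icc 0 t)))
      atTop (𝓝 0) ∧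
    Tendsto J atTop (𝓝 I)

/-- `I = ∫_0^t db_s y_s = ∫_0^t dc_s y_s + ∫_0^t d y_s ds` for a cocycle `b` with centred part `c` and
drift coefficient `d`. -/
def HasStochasticIntegral (b : ℝ → L2 τ) (t : ℝ) (y : ℝ → L2 τ) (I : L2 τ) : Prop :=
  ∃ (J : L2 τ) (g : ℝ → L2 τ),
    W.HasItoIntegral (W.centredPart b) t y J ∧
    IntegrableOn g (Set.Icc 0 t) ∧
    (∀ᵐ r ∂volume.restrict (Set.Icc 0 t), IsMul τ (W.driftCoeff b) (y r) (g r)) ∧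
    I = J + ∫ r in Set.Icc 0 t, g r

/-- The Hilbert space `H([0, T])` of (classes of) adapted square integrable `L²(A, τ)`-valued
functions on `[0, T]`. -/
def adaptedProcesses (T : ℝ) :
    Submodule ℂ (Lp (L2 τ) 2 (volume.restrict (Set.Icc (0 : ℝ) T))) where
  carrier := {y | ∀ᵐ s ∂volume.restrict (Set.Icc (0 : ℝ) T), y s ∈ W.adaptedSpace s}
  zero_mem' := by
    filter_upwards [Lp.coeFn_zero (L2 τ) 2 (volume.restrict (Set.Icc (0 : ℝ) T))] with s hs
    rw [hs]
    exact Submodule.zero_mem _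
  add_mem' {x y} hx hy := by
    filter_upwards [hx, hy, Lp.coeFn_add x y] with s h₁ h₂ hs
    rw [hs]
    exact Submodule.add_mem _ h₁ h₂
  smul_mem' a {x} hx := by
    filter_upwards [hx, Lp.coeFn_smul a x] with s h₁ hs
    rw [hs]
    exact Submodule.smul_mem _ a h₁

/-- `y_t = 1 + ∫_0^t db_s y_s`, as an equation in `H([0, T])`, i.e. for almost every `t ∈ [0, T]`. -/
def IsSolution (b : ℝ → L2 τ) (T : ℝ) (y : W.adaptedProcesses T) : Prop :=
  ∀ᵐ t ∂volume.restrict (Set.Icc (0 : ℝ) T),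
    W.HasStochasticIntegral b t (fun s => y.1 s) (y.1 t - toL2 τ 1)

end WhiteNoise

end NCWhiteNoise

end

/-!
The equation `y_t = 1 + ∫_0^t db_s y_s` is solved by Picard iteration in the Hilbert space of
adapted square integrable processes. Everything rests on the inequality
`‖∫_0^t dc_s y_s‖² ≤ K ∫_0^t ‖y_s‖² ds` for the centred part `c` of the cocycle, where `K` is the
norm of the covariance of `b`. It holds because increments of `c` are orthogonal to the past and
act on the past as bounded operators.

Boundedness of the increments: for `a ∈ A₀` the function `t ↦ ‖c_t a‖₂²` is nonnegative and
additive, and at `t = 1` it is at most `K ‖a‖₂²`, so it is at most `K t ‖a‖₂²`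
(`IsAdditiveCocycle.norm_rightMul_centredPart_le`). To replace `a ∈ A₀` by an element `y` of the
past, which is independent of the increment `x`, one writes `‖x y‖₂² = τ(x* x E₀(y y*))`
(`norm_rightMul_sq_le_of_independent`). Here `x` is unbounded, and `E₀(y y*)` is so far only a
vector of `L²(A₀, τ)`. But it is the limit in `‖·‖₂` of bounded sequences of squares `s²` with
`s ∈ A₀` self-adjoint, because truncating the spectrum of an approximation is a metric projection
in `L²` (`norm_sub_clamp_le`). This needs only that von Neumann subalgebras are closed in norm. The
same argument shows that the drift coefficient `d`, which satisfies `‖d a‖₂² ≤ K ‖a‖₂²` on `A₀`,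
acts on all adapted vectors as a bounded operator.

The rest takes place in an abstract Hilbert space with a filtration (`ItoSystem`). The Itô integral
is given by its graph, the closure of the span of the pairs `(y χ_{[s, t)}, (c_t - c_s) y)` in
`L²(ℝ; H) × H`. The Itô inequality holds on the span, since finitely many simple processes have a
common partition, hence on the closure, which is therefore the graph of an operator
(`norm_sq_le_of_mem_itoGraph`). Its domain contains all adapted processes, since these are
approximated by their averages over preceding cells of an equidistant partition
(`exists_simple_approx`). Finally the map `y ↦ η + ∫_0^t dc y + ∫_0^t D y ds` changes
`‖y_t - y'_t‖²` at most into a multiple of `∫_0^t ‖y_s - y'_s‖² ds`, so one of its iterates is a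
contraction (`existsUnique_fixedPoint`).
-/

namespace NCWhiteNoise

/-- A von Neumann subalgebra is closed in norm. -/
theorem IsVNSubalgebra.isClosed {A X : Type*} [CStarAlgebra A] [NormedAddCommGroup X]
    [NormedSpace ℂ X] {e : StrongDual ℂ X ≃ₗᵢ[ℂ] A} {N : StarSubalgebra ℂ A}
    (hN : IsVNSubalgebra e N) : IsClosed (N : Set A) := by
  refine hN.mono (continuous_iff_le_induced.1 (continuous_pi fun ξ => ?_))
  exact ((ContinuousLinearMap.apply ℂ ℂ ξ).continuous).comp e.symm.continuous

section Algebra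

/-! ### Multiplication and adjoint on `L²(A, τ)` -/

variable {A X : Type*} [CStarAlgebra A] [PartialOrder A] [StarOrderedRing A]
  [NormedAddCommGroup X] [NormedSpace ℂ X] {e : StrongDual ℂ X ≃ₗᵢ[ℂ] A} (τ : TracialState e)

theorem toL2_add (a b : A) : toL2 τ (a + b) = toL2 τ a + toL2 τ b := by
  simp [toL2, UniformSpace.Completion.coe_add]

theorem toL2_smul (c : ℂ) (a : A) : toL2 τ (c • a) = c • toL2 τ a := by
  simp [toL2, UniformSpace.Completion.coe_smul]

theorem toL2_sub (a b : A) : toL2 τ (a - b) = toL2 τ a - toL2 τ b := by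
  simp [toL2, UniformSpace.Completion.coe_sub]

theorem toL2_zero : toL2 τ 0 = 0 := by
  simpa using toL2_smul τ 0 0

theorem inner_toL2 (a b : A) :
    ⟪toL2 τ a, toL2 τ b⟫_ℂ = τ.toPositiveLinearMap (star a * b) := by
  simp [toL2, UniformSpace.Completion.inner_coe, PositiveLinearMap.preGNS_inner_def]

theorem leftMul_toL2 (a b : A) : leftMul τ a (toL2 τ b) = toL2 τ (a * b) := by
  simp [leftMul, toL2]

theorem denseRange_toL2 : DenseRange (toL2 τ) := by
  have h := UniformSpace.Completion.denseRange_coe (α := τ.toPositiveLinearMap.PreGNS)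
  exact h.comp τ.toPositiveLinearMap.toPreGNS.surjective.denseRange
    (UniformSpace.Completion.continuous_coe _)

theorem norm_leftMul_apply_le (a : A) (x : L2 τ) : ‖leftMul τ a x‖ ≤ ‖a‖ * ‖x‖ :=
  ((leftMul τ a).le_opNorm x).trans (mul_le_mul_of_nonneg_right
    (NonUnitalStarAlgHom.norm_apply_le τ.toPositiveLinearMap.gnsStarAlgHom a) (norm_nonneg x))

theorem leftMul_mul_apply (a b : A) (x : L2 τ) :
    leftMul τ (a * b) x = leftMul τ a (leftMul τ b x) := by
  simp only [leftMul, map_mul]; rfl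

theorem inner_leftMul (a : A) (x y : L2 τ) :
    ⟪leftMul τ a x, y⟫_ℂ = ⟪x, leftMul τ (star a) y⟫_ℂ := by
  simp only [leftMul, map_star, ContinuousLinearMap.star_eq_adjoint,
    ContinuousLinearMap.adjoint_inner_right]

theorem continuous_adj : Continuous (adj τ) := UniformSpace.Completion.continuous_map

/-- Two continuous maps on `L²(A, τ)` agree if they agree on `A`. -/
theorem L2_ext {Y : Type*} [TopologicalSpace Y] [T2Space Y] {f g : L2 τ → Y} (hf : Continuous f)
    (hg : Continuous g) (h : ∀ a, f (toL2 τ a) = g (toL2 τ a)) (x : L2 τ) : f x = g x :=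
  congrFun ((denseRange_toL2 τ).equalizer hf hg (funext h)) x

/-- A vector of `L²(A, τ)` is determined by its inner products with the elements of `A`. -/
theorem eq_of_inner_toL2 {x y : L2 τ} (h : ∀ a, ⟪toL2 τ a, x⟫_ℂ = ⟪toL2 τ a, y⟫_ℂ) : x = y :=
  ext_inner_left ℂ fun v => L2_ext τ (f := fun v => ⟪v, x⟫_ℂ) (g := fun v => ⟪v, y⟫_ℂ)
    (by fun_prop) (by fun_prop) h v

theorem inner_adj_adj (x y : L2 τ) : ⟪adj τ x, adj τ y⟫_ℂ = ⟪y, x⟫_ℂ := by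
  have hc := continuous_adj τ
  refine L2_ext τ (f := fun x => ⟪adj τ x, adj τ y⟫_ℂ) (g := fun x => ⟪y, x⟫_ℂ)
    (by fun_prop) (by fun_prop) (fun a => ?_) x
  refine L2_ext τ (f := fun y => ⟪adj τ (toL2 τ a), adj τ y⟫_ℂ) (g := fun y => ⟪y, toL2 τ a⟫_ℂ)
    (by fun_prop) (by fun_prop) (fun b => ?_) y
  simp only [adj_toL2, inner_toL2, star_star]
  exact τ.tracial _ _

theorem adj_adj (x : L2 τ) : adj τ (adj τ x) = x :=
  L2_ext τ ((continuous_adj τ).comp (continuous_adj τ)) continuous_id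
    (fun a => by simp [adj_toL2]) x

theorem adj_add (x y : L2 τ) : adj τ (x + y) = adj τ x + adj τ y := by
  refine ext_inner_right ℂ fun v => ?_
  rw [← adj_adj τ v, inner_add_left, inner_adj_adj, inner_adj_adj, inner_adj_adj, inner_add_right]

theorem adj_smul (c : ℂ) (x : L2 τ) : adj τ (c • x) = star c • adj τ x := by
  refine ext_inner_right ℂ fun v => ?_
  rw [← adj_adj τ v, inner_smul_left, inner_adj_adj, inner_adj_adj, inner_smul_right]
  simp

theorem norm_adj (x : L2 τ) : ‖adj τ x‖ = ‖x‖ := by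
  rw [norm_eq_sqrt_re_inner (𝕜 := ℂ), inner_adj_adj, ← norm_eq_sqrt_re_inner]

/-- Right multiplication by `a ∈ A` on `L²(A, τ)`, as `x ↦ (a* x*)*`. -/
noncomputable def rightMul (a : A) : L2 τ →L[ℂ] L2 τ :=
  LinearMap.mkContinuous
    { toFun := fun x => adj τ (leftMul τ (star a) (adj τ x))
      map_add' := fun x y => by simp only [adj_add, map_add]
      map_smul' := fun c x => by simp only [adj_smul, map_smul, star_star, RingHom.id_apply] }
    ‖a‖ fun x => by
      simp only [LinearMap.coe_mk, AddHom.coe_mk, norm_adj]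
      simpa [norm_adj] using norm_leftMul_apply_le τ (star a) (adj τ x)

theorem rightMul_apply (a : A) (x : L2 τ) :
    rightMul τ a x = adj τ (leftMul τ (star a) (adj τ x)) := rfl

theorem rightMul_toL2 (a b : A) : rightMul τ a (toL2 τ b) = toL2 τ (b * a) := by
  simp [rightMul_apply, adj_toL2, leftMul_toL2]

theorem norm_rightMul_apply_le (a : A) (x : L2 τ) : ‖rightMul τ a x‖ ≤ ‖a‖ * ‖x‖ := by
  rw [rightMul_apply, norm_adj]
  simpa [norm_adj] using norm_leftMul_apply_le τ (star a) (adj τ x)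

theorem rightMul_mul_apply (a b : A) (x : L2 τ) :
    rightMul τ (a * b) x = rightMul τ b (rightMul τ a x) := by
  simp [rightMul_apply, adj_adj, leftMul_mul_apply]

theorem inner_rightMul (a : A) (x y : L2 τ) :
    ⟪rightMul τ a x, y⟫_ℂ = ⟪x, rightMul τ (star a) y⟫_ℂ := by
  rw [rightMul_apply, rightMul_apply, ← adj_adj τ y, inner_adj_adj, adj_adj, star_star,
    ← adj_adj τ x, inner_adj_adj, adj_adj, inner_leftMul]

theorem rightMul_add_apply (a b : A) (x : L2 τ) :
    rightMul τ (a + b) x = rightMul τ a x + rightMul τ b x := by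
  simp [rightMul_apply, leftMul, adj_add]

theorem norm_toL2_sq (a : A) : ‖toL2 τ a‖ ^ 2 = (τ.toPositiveLinearMap (star a * a)).re := by
  rw [← inner_toL2, norm_sq_eq_re_inner (𝕜 := ℂ)]; rfl

/-! ### Products in `L²(A, τ)` -/

theorem isMul_toL2_iff (x z : L2 τ) (y : A) : IsMul τ x (toL2 τ y) z ↔ z = rightMul τ y x := by
  have key (a : A) : ⟪adj τ (leftMul τ (star a) x), toL2 τ y⟫_ℂ
      = ⟪toL2 τ a, rightMul τ y x⟫_ℂ := by
    rw [← star_star y, ← adj_toL2, inner_adj_adj, ← inner_conj_symm, inner_leftMul, inner_conj_symm,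
      leftMul_toL2, star_star, star_star, ← rightMul_toL2, inner_rightMul, star_star]
  refine ⟨fun h => eq_of_inner_toL2 τ fun a => ?_, fun h a => ?_⟩
  · rw [← h a, key]
  · rw [key, h]

variable {τ}

theorem IsMul.unique {x y z z' : L2 τ} (h : IsMul τ x y z) (h' : IsMul τ x y z') : z = z' :=
  eq_of_inner_toL2 τ fun a => (h a).symm.trans (h' a)

/-- The product is closed in its second argument and the value. -/
theorem IsMul.of_tendsto {ι : Type*} {l : Filter ι} [l.NeBot] {x y z : L2 τ} {u v : ι → L2 τ}
    (h : ∀ i, IsMul τ x (u i) (v i)) (hu : Tendsto u l (𝓝 y)) (hv : Tendsto v l (𝓝 z)) :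
    IsMul τ x y z := fun a =>
  tendsto_nhds_unique (tendsto_const_nhds.inner hu)
    ((tendsto_const_nhds.inner hv).congr fun i => (h i a).symm)

theorem IsMul.add_right {x y z y' z' : L2 τ} (h : IsMul τ x y z) (h' : IsMul τ x y' z') :
    IsMul τ x (y + y') (z + z') := fun a => by
  rw [inner_add_right, inner_add_right, h a, h' a]

theorem IsMul.smul_right {x y z : L2 τ} (c : ℂ) (h : IsMul τ x y z) :
    IsMul τ x (c • y) (c • z) := fun a => by
  rw [inner_smul_right, inner_smul_right, h a]

theorem IsMul.add_left {x x' y z z' : L2 τ} (h : IsMul τ x y z) (h' : IsMul τ x' y z') :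
    IsMul τ (x + x') y (z + z') := fun a => by
  rw [map_add, adj_add, inner_add_left, inner_add_right, h a, h' a]

variable (τ)

/-! ### The subspaces `L²(N, τ)` -/

theorem toL2_mem_L2Sub {N : StarSubalgebra ℂ A} {a : A} (ha : a ∈ N) : toL2 τ a ∈ L2Sub τ N :=
  Submodule.le_topologicalClosure _ (Submodule.subset_span ⟨a, ha, rfl⟩)

theorem isClosed_L2Sub (N : StarSubalgebra ℂ A) : IsClosed (L2Sub τ N : Set (L2 τ)) :=
  Submodule.isClosed_topologicalClosure _

/-- `L²(N, τ)` is the closure of `N`, without passing to the linear span. -/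
theorem coe_L2Sub (N : StarSubalgebra ℂ A) :
    (L2Sub τ N : Set (L2 τ)) = closure (toL2 τ '' (N : Set A)) := by
  have : (Submodule.span ℂ (toL2 τ '' (N : Set A)) : Set (L2 τ)) = toL2 τ '' (N : Set A) := by
    refine subset_antisymm (fun x hx => ?_) Submodule.subset_span
    induction hx using Submodule.span_induction with
    | mem x hx => exact hx
    | zero => exact ⟨0, N.zero_mem, toL2_zero τ⟩
    | add x y _ _ hx hy =>
      obtain ⟨a, ha, rfl⟩ := hx
      obtain ⟨b, hb, rfl⟩ := hy
      exact ⟨a + b, N.add_mem ha hb, toL2_add τ a b⟩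
    | smul c x _ hx =>
      obtain ⟨a, ha, rfl⟩ := hx
      exact ⟨c • a, N.smul_mem ha c, toL2_smul τ c a⟩
  rw [L2Sub, Submodule.topologicalClosure_coe, this]

/-- Every vector of `L²(N, τ)` is the limit of a sequence in `N`. -/
theorem exists_seq_of_mem_L2Sub {N : StarSubalgebra ℂ A} {x : L2 τ} (hx : x ∈ L2Sub τ N) :
    ∃ a : ℕ → A, (∀ n, a n ∈ N) ∧ Tendsto (fun n => toL2 τ (a n)) atTop (𝓝 x) := by
  rw [← SetLike.mem_coe, coe_L2Sub] at hx
  obtain ⟨u, hu, hlim⟩ := mem_closure_iff_seq_limit.1 hx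
  choose a ha hau using hu
  exact ⟨a, ha, by simpa only [hau] using hlim⟩

/-- A continuous map sending `N` into a closed set `s` sends `L²(N, τ)` into `s`. -/
theorem map_mem_of_mem_L2Sub {Y : Type*} [TopologicalSpace Y] {N : StarSubalgebra ℂ A}
    {s : Set Y} (hs : IsClosed s) {f : L2 τ → Y} (hf : Continuous f)
    (h : ∀ a ∈ N, f (toL2 τ a) ∈ s) {x : L2 τ} (hx : x ∈ L2Sub τ N) : f x ∈ s := by
  obtain ⟨a, ha, hlim⟩ := exists_seq_of_mem_L2Sub τ hx
  exact hs.mem_of_tendsto ((hf.tendsto x).comp hlim) (.of_forall fun n => h _ (ha n))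

theorem L2Sub_mono {N M : StarSubalgebra ℂ A} (h : N ≤ M) : L2Sub τ N ≤ L2Sub τ M := fun _ hx =>
  map_mem_of_mem_L2Sub τ (isClosed_L2Sub τ M) continuous_id
    (fun _ ha => toL2_mem_L2Sub τ (h ha)) hx

theorem adj_mem_L2Sub {N : StarSubalgebra ℂ A} {x : L2 τ} (hx : x ∈ L2Sub τ N) :
    adj τ x ∈ L2Sub τ N :=
  map_mem_of_mem_L2Sub τ (isClosed_L2Sub τ N) (continuous_adj τ)
    (fun a ha => by rw [adj_toL2]; exact toL2_mem_L2Sub τ (star_mem ha)) hx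

theorem rightMul_mem_L2Sub {N : StarSubalgebra ℂ A} {a : A} (ha : a ∈ N) {x : L2 τ}
    (hx : x ∈ L2Sub τ N) : rightMul τ a x ∈ L2Sub τ N :=
  map_mem_of_mem_L2Sub τ (isClosed_L2Sub τ N) (rightMul τ a).continuous
    (fun b hb => by rw [rightMul_toL2]; exact toL2_mem_L2Sub τ (mul_mem hb ha)) hx

theorem traceCondExp_mem (N : StarSubalgebra ℂ A) (x : L2 τ) : traceCondExp τ N x ∈ L2Sub τ N :=
  Submodule.starProjection_apply_mem _ x

theorem traceCondExp_of_mem {N : StarSubalgebra ℂ A} {x : L2 τ} (hx : x ∈ L2Sub τ N) :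
    traceCondExp τ N x = x :=
  Submodule.starProjection_eq_self_iff.2 hx

theorem inner_traceCondExp (N : StarSubalgebra ℂ A) (x y : L2 τ) :
    ⟪traceCondExp τ N x, y⟫_ℂ = ⟪x, traceCondExp τ N y⟫_ℂ :=
  Submodule.inner_starProjection_left_eq_right _ x y

theorem inner_traceCondExp_of_mem {N : StarSubalgebra ℂ A} {x : L2 τ} (hx : x ∈ L2Sub τ N)
    (y : L2 τ) : ⟪x, traceCondExp τ N y⟫_ℂ = ⟪x, y⟫_ℂ := by
  rw [← inner_traceCondExp, traceCondExp_of_mem τ hx]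

theorem traceCondExp_eq_of_inner {N : StarSubalgebra ℂ A} {x y : L2 τ} (hy : y ∈ L2Sub τ N)
    (h : ∀ a ∈ N, ⟪toL2 τ a, x⟫_ℂ = ⟪toL2 τ a, y⟫_ℂ) : traceCondExp τ N x = y := by
  have h' : ∀ v ∈ L2Sub τ N, ⟪v, x⟫_ℂ = ⟪v, y⟫_ℂ := fun v hv =>
    map_mem_of_mem_L2Sub τ (isClosed_eq (f := fun v => ⟪v, x⟫_ℂ) (g := fun v => ⟪v, y⟫_ℂ)
      (by fun_prop) (by fun_prop)) continuous_id h hv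
  refine Submodule.eq_starProjection_of_mem_of_inner_eq_zero hy (fun w hw => ?_)
  rw [inner_sub_left, ← inner_conj_symm, h' w hw, inner_conj_symm, sub_self]

theorem trace_mul_nonneg {a b : A} (ha : 0 ≤ a) (hb : 0 ≤ b) :
    0 ≤ τ.toPositiveLinearMap (a * b) := by
  have hs : star (CFC.sqrt b) = CFC.sqrt b := (CFC.sqrt_nonneg b).isSelfAdjoint.star_eq
  have : τ.toPositiveLinearMap (a * b)
      = τ.toPositiveLinearMap (star (CFC.sqrt b) * a * CFC.sqrt b) := by
    rw [hs, mul_assoc]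
    conv_lhs => rw [← CFC.sqrt_mul_sqrt_self b, ← mul_assoc]
    exact τ.tracial _ _
  rw [this]
  exact τ.toPositiveLinearMap.map_nonneg (star_left_conjugate_nonneg ha _)

end Algebra

section Independence

variable {A X : Type*} [CStarAlgebra A] [PartialOrder A] [StarOrderedRing A]
  [NormedAddCommGroup X] [NormedSpace ℂ X] {e : StrongDual ℂ X ≃ₗᵢ[ℂ] A} (τ : TracialState e)

/-! ### Bounded approximation of conditional expectations -/

/-- Truncating the spectrum of a self-adjoint `c` to `[0, M]` moves it in `‖·‖₂` no further than its
distance to any `v` which lies between `0` and `M` in the weak sense of the inner products with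
positive elements of `N`: the truncation is the metric projection onto a convex set. -/
theorem norm_sub_clamp_le {N : StarSubalgebra ℂ A} (hN : IsClosed (N : Set A)) {M : ℝ} (hM : 0 ≤ M)
    {v : L2 τ} (hv : ∀ p ∈ N, 0 ≤ p →
      0 ≤ (⟪toL2 τ p, v⟫_ℂ).re ∧ (⟪toL2 τ p, v⟫_ℂ).re ≤ M * (τ.toPositiveLinearMap p).re)
    {c : A} (hc : c ∈ N) (hsa : IsSelfAdjoint c) :
    ‖toL2 τ c - toL2 τ (cfc (fun t : ℝ => max 0 (min t M)) c)‖ ≤ ‖toL2 τ c - v‖ := by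
  set f : A := cfc (fun t : ℝ => max 0 (min t M)) c with hf
  set p : A := cfc (fun t : ℝ => max (t - M) 0) c with hp
  set q : A := cfc (fun t : ℝ => max (-t) 0) c with hq
  have hpN : p ∈ N := cfc_mem (𝕜' := ℂ) (hs := hN) _ hc
  have hqN : q ∈ N := cfc_mem (𝕜' := ℂ) (hs := hN) _ hc
  have hp0 : 0 ≤ p := cfc_nonneg fun t _ => le_max_right _ _
  have hq0 : 0 ≤ q := cfc_nonneg fun t _ => le_max_right _ _
  have hdec : c - f = p - q := by
    conv_lhs => rw [← cfc_id' ℝ c]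
    rw [hf, hp, hq, ← cfc_sub .., ← cfc_sub ..]
    refine cfc_congr fun t _ => ?_
    show t - max 0 (min t M) = max (t - M) 0 - max (-t) 0
    rcases le_total t 0 with h | h
    · rw [min_eq_left (by linarith), max_eq_left h, max_eq_right (by linarith),
        max_eq_left (by linarith)]; ring
    · rcases le_total t M with h' | h'
      · rw [min_eq_left h', max_eq_right h, max_eq_right (by linarith),
          max_eq_right (by linarith)]; ring
      · rw [min_eq_right h', max_eq_right hM, max_eq_left (by linarith),
          max_eq_right (by linarith)]; ring
  have hpf : p * f = M • p := by
    rw [hf, hp, ← cfc_mul .., ← cfc_const_mul ..]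
    refine cfc_congr fun t _ => ?_
    show max (t - M) 0 * max 0 (min t M) = M * max (t - M) 0
    rcases le_total t M with h' | h'
    · rw [max_eq_right (by linarith)]; ring
    · rw [min_eq_right h', max_eq_right hM]; ring
  have hqf : q * f = 0 := by
    rw [hf, hq, ← cfc_mul .., ← cfc_zero ℝ c]
    refine cfc_congr fun t _ => ?_
    show max (-t) 0 * max 0 (min t M) = 0
    rcases le_total t 0 with h | h
    · rw [max_eq_left (a := 0) ((min_le_left _ _).trans h)]; ring
    · rw [max_eq_right (by linarith)]; ring
  have hpi : (⟪toL2 τ p, v - toL2 τ f⟫_ℂ).re ≤ 0 := by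
    have h2 : (M • p : A) = (M : ℂ) • p := (Complex.coe_smul M p).symm
    rw [inner_sub_right, inner_toL2, hp0.isSelfAdjoint.star_eq, hpf, Complex.sub_re, h2, map_smul]
    have := (hv p hpN hp0).2
    simp only [smul_eq_mul, Complex.re_ofReal_mul]
    linarith
  have hqi : 0 ≤ (⟪toL2 τ q, v - toL2 τ f⟫_ℂ).re := by
    rw [inner_sub_right, inner_toL2, hq0.isSelfAdjoint.star_eq, hqf, map_zero, sub_zero]
    exact (hv q hqN hq0).1
  have hle : ‖toL2 τ c - toL2 τ f‖ ^ 2 ≤ ‖toL2 τ c - toL2 τ f‖ * ‖toL2 τ c - v‖ := by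
    calc ‖toL2 τ c - toL2 τ f‖ ^ 2
        = (⟪toL2 τ c - toL2 τ f, toL2 τ c - v⟫_ℂ).re
          + (⟪toL2 τ c - toL2 τ f, v - toL2 τ f⟫_ℂ).re := by
          rw [← Complex.add_re, ← inner_add_right, sub_add_sub_cancel,
            norm_sq_eq_re_inner (𝕜 := ℂ)]; rfl
      _ ≤ (⟪toL2 τ c - toL2 τ f, toL2 τ c - v⟫_ℂ).re + 0 := by
          gcongr
          rw [← toL2_sub, hdec, toL2_sub, inner_sub_left, Complex.sub_re]
          linarith
      _ ≤ _ := by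
          rw [add_zero]
          exact (Complex.re_le_norm _).trans (norm_inner_le_norm _ _)
  rcases (norm_nonneg (toL2 τ c - toL2 τ f)).eq_or_lt with h0 | h0
  · rw [← h0]; exact norm_nonneg _
  · nlinarith

/-- The conditional expectation in `L²` of a bounded positive `h` is the limit in `‖·‖₂` of squares
`s²` of self-adjoint elements of `N` with `‖s²‖ ≤ ‖h‖`. -/
theorem exists_seq_tendsto_traceCondExp {N : StarSubalgebra ℂ A} (hN : IsClosed (N : Set A))
    {h : A} (hh : 0 ≤ h) : ∃ s : ℕ → A, (∀ n, s n ∈ N) ∧ (∀ n, star (s n) = s n) ∧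
      (∀ n, ‖s n * s n‖ ≤ ‖h‖) ∧
      Tendsto (fun n => toL2 τ (s n * s n)) atTop (𝓝 (traceCondExp τ N (toL2 τ h))) := by
  set v := traceCondExp τ N (toL2 τ h) with hv_def
  have hvN : v ∈ L2Sub τ N := traceCondExp_mem τ N _
  have hinner : ∀ p ∈ N, ⟪toL2 τ p, v⟫_ℂ = τ.toPositiveLinearMap (star p * h) := fun p hp => by
    rw [hv_def, inner_traceCondExp_of_mem τ (toL2_mem_L2Sub τ hp), inner_toL2]
  have hadj : adj τ v = v := by
    refine (traceCondExp_eq_of_inner τ (adj_mem_L2Sub τ hvN) fun a ha => ?_).symm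
    rw [← star_star a, ← adj_toL2, inner_adj_adj, ← inner_conj_symm v, hinner _ (star_mem ha),
      star_star, ← adj_adj τ (toL2 τ h), inner_adj_adj, adj_toL2, hh.isSelfAdjoint.star_eq,
      ← inner_conj_symm, inner_toL2]
    simp
  have hv : ∀ p ∈ N, 0 ≤ p → 0 ≤ (⟪toL2 τ p, v⟫_ℂ).re ∧
      (⟪toL2 τ p, v⟫_ℂ).re ≤ ‖h‖ * (τ.toPositiveLinearMap p).re := fun p hp hp0 => by
    rw [hinner p hp, hp0.isSelfAdjoint.star_eq]
    refine ⟨(Complex.nonneg_iff.1 (trace_mul_nonneg τ hp0 hh)).1, ?_⟩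
    have h1 : 0 ≤ algebraMap ℝ A ‖h‖ - h :=
      sub_nonneg.2 (IsSelfAdjoint.le_algebraMap_norm_self hh.isSelfAdjoint)
    have h2 := (Complex.nonneg_iff.1 (trace_mul_nonneg τ hp0 h1)).1
    have h3 : p * algebraMap ℝ A ‖h‖ = (‖h‖ : ℂ) • p := by
      rw [← Algebra.commutes, ← Algebra.smul_def, Complex.coe_smul]
    rw [mul_sub, map_sub, h3, map_smul, Complex.sub_re, smul_eq_mul, Complex.re_ofReal_mul] at h2
    linarith
  obtain ⟨b, hbN, hb⟩ := exists_seq_of_mem_L2Sub τ hvN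
  set c : ℕ → A := fun n => (2⁻¹ : ℂ) • (b n + star (b n)) with hc
  have hcN : ∀ n, c n ∈ N := fun n => N.smul_mem (add_mem (hbN n) (star_mem (hbN n))) _
  have hcsa : ∀ n, IsSelfAdjoint (c n) := fun n => by
    rw [IsSelfAdjoint, hc]; simp [add_comm]
  have hclim : Tendsto (fun n => toL2 τ (c n)) atTop (𝓝 v) := by
    have h1 := (hb.add (((continuous_adj τ).tendsto v).comp hb)).const_smul (2⁻¹ : ℂ)
    have h2 : (2⁻¹ : ℂ) • (v + adj τ v) = v := by
      rw [hadj, ← two_smul ℂ v, smul_smul]; norm_num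
    rw [h2] at h1
    refine h1.congr fun n => ?_
    simp only [hc, toL2_smul, toL2_add, Function.comp_apply, adj_toL2]
  set s : ℕ → A := fun n => cfc (fun t : ℝ => √(max 0 (min t ‖h‖))) (c n) with hs
  have hss : ∀ n, s n * s n = cfc (fun t : ℝ => max 0 (min t ‖h‖)) (c n) := fun n => by
    rw [hs]
    simp only
    rw [← cfc_mul ..]
    exact cfc_congr fun t _ => Real.mul_self_sqrt (le_max_left _ _)
  refine ⟨s, fun n => cfc_mem (𝕜' := ℂ) (hs := hN) _ (hcN n), fun n => ?_, fun n => ?_, ?_⟩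
  · exact (cfc_predicate _ _ : IsSelfAdjoint (s n)).star_eq
  · rw [hss]
    refine norm_cfc_le (norm_nonneg h) fun t _ => ?_
    rw [Real.norm_eq_abs, abs_of_nonneg (le_max_left _ _)]
    exact max_le (norm_nonneg h) (min_le_right _ _)
  · have hsub : Tendsto (fun n => toL2 τ (c n) - toL2 τ (s n * s n)) atTop (𝓝 0) := by
      refine squeeze_zero_norm (fun n => ?_)
        (by simpa using (hclim.sub_const v).norm : Tendsto (fun n => ‖toL2 τ (c n) - v‖) _ _)
      rw [hss]
      exact norm_sub_clamp_le τ hN (norm_nonneg h) hv (hcN n) (hcsa n)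
    simpa using hclim.sub hsub

/-! ### Products of independent factors -/

variable {N I J : StarSubalgebra ℂ A}

theorem inner_eq_inner_traceCondExp (hind : traceCondExp τ I ∘L traceCondExp τ J = traceCondExp τ N)
    {u w : L2 τ} (hu : u ∈ L2Sub τ I) (hw : w ∈ L2Sub τ J) :
    ⟪u, w⟫_ℂ = ⟪u, traceCondExp τ N w⟫_ℂ := by
  rw [← hind, ContinuousLinearMap.comp_apply, inner_traceCondExp_of_mem τ hu,
    traceCondExp_of_mem τ hw]

/-- The product of independent factors of which the first has conditional expectation zero is
orthogonal to everything in the algebra of the second. -/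
theorem inner_rightMul_eq_zero (hind : traceCondExp τ J ∘L traceCondExp τ I = traceCondExp τ N)
    {x w : L2 τ} (hx : x ∈ L2Sub τ I) (h0 : traceCondExp τ N x = 0) (hw : w ∈ L2Sub τ J)
    {y : A} (hy : y ∈ J) : ⟪w, rightMul τ y x⟫_ℂ = 0 := by
  rw [← star_star y, ← inner_rightMul,
    inner_eq_inner_traceCondExp τ hind (rightMul_mem_L2Sub τ (star_mem hy) hw) hx, h0,
    inner_zero_right]

theorem norm_rightMul_toL2_sq (x y : A) : ((‖rightMul τ y (toL2 τ x)‖ ^ 2 : ℝ) : ℂ)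
    = ⟪toL2 τ (star x * x), toL2 τ (y * star y)⟫_ℂ := by
  rw [rightMul_toL2, Complex.ofReal_pow]
  refine (inner_self_eq_norm_sq_to_K (𝕜 := ℂ) (toL2 τ (x * y))).symm.trans ?_
  rw [inner_toL2, inner_toL2, star_mul, star_mul, star_star, ← mul_assoc (star x * x)]
  rw [show star y * star x * (x * y) = star y * (star x * x * y) by simp only [mul_assoc]]
  exact τ.tracial _ _

/-- If right multiplication of `x` by elements of `N` is bounded in `‖·‖₂`, then so is right
multiplication of `x` by elements of an algebra which is independent of `x` over `N`. In terms of
conditional expectations: `‖x y‖₂² = τ(x* x E_N(y y*))`, and `E_N(y y*)` can be replaced by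
squares of elements of `N`. -/
theorem norm_rightMul_sq_le_of_independent (hN : IsClosed (N : Set A))
    (hind : traceCondExp τ I ∘L traceCondExp τ J = traceCondExp τ N) {x : L2 τ}
    (hx : x ∈ L2Sub τ I) {C : ℝ} (hC : ∀ a ∈ N, ‖rightMul τ a x‖ ^ 2 ≤ C * ‖toL2 τ a‖ ^ 2)
    {y : A} (hy : y ∈ J) : ‖rightMul τ y x‖ ^ 2 ≤ C * ‖toL2 τ y‖ ^ 2 := by
  set h := y * star y with hh
  obtain ⟨s, hsN, hsa, hsM, hlim⟩ :=
    exists_seq_tendsto_traceCondExp τ hN (mul_star_self_nonneg y)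
  rw [← hh] at hsM hlim
  have hhJ : toL2 τ h ∈ L2Sub τ J := toL2_mem_L2Sub τ (mul_mem hy (star_mem hy))
  -- The quadratic forms of the right multiplications by `s²` are equicontinuous in `x`.
  have hdiff : ∀ (x' : L2 τ) n, (⟪x', rightMul τ (s n * s n) x'⟫_ℂ).re
      ≤ (⟪x, rightMul τ (s n * s n) x⟫_ℂ).re + ‖h‖ * ‖x' - x‖ * (‖x'‖ + ‖x‖) := fun x' n => by
    set R := rightMul τ (s n * s n)
    have hR : ∀ u, ‖R u‖ ≤ ‖h‖ * ‖u‖ := fun u => (norm_rightMul_apply_le τ _ u).trans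
      (mul_le_mul_of_nonneg_right (hsM n) (norm_nonneg u))
    have hsplit : ⟪x', R x'⟫_ℂ = ⟪x, R x⟫_ℂ + (⟪x' - x, R x'⟫_ℂ + ⟪x, R (x' - x)⟫_ℂ) := by
      simp only [map_sub, inner_sub_left, inner_sub_right]; ring
    rw [hsplit, Complex.add_re, Complex.add_re]
    have h1 : (⟪x' - x, R x'⟫_ℂ).re ≤ ‖x' - x‖ * (‖h‖ * ‖x'‖) :=
      (Complex.re_le_norm _).trans ((norm_inner_le_norm _ _).trans (by gcongr; exact hR x'))
    have h2 : (⟪x, R (x' - x)⟫_ℂ).re ≤ ‖x‖ * (‖h‖ * ‖x' - x‖) :=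
      (Complex.re_le_norm _).trans ((norm_inner_le_norm _ _).trans (by gcongr; exact hR _))
    linarith
  have hbound : ∀ n, (⟪x, rightMul τ (s n * s n) x⟫_ℂ).re
      ≤ C * (⟪toL2 τ 1, toL2 τ (s n * s n)⟫_ℂ).re := fun n => by
    have h1 : ⟪x, rightMul τ (s n * s n) x⟫_ℂ = ⟪rightMul τ (s n) x, rightMul τ (s n) x⟫_ℂ := by
      rw [rightMul_mul_apply, inner_rightMul τ (s n) x, hsa]
    have h2 := hC (s n) (hsN n)
    rw [norm_toL2_sq, hsa, norm_sq_eq_re_inner (𝕜 := ℂ)] at h2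
    rw [h1, inner_toL2, star_one, one_mul]
    exact h2
  have hone : (⟪toL2 τ 1, traceCondExp τ N (toL2 τ h)⟫_ℂ).re = ‖toL2 τ y‖ ^ 2 := by
    rw [inner_traceCondExp_of_mem τ (toL2_mem_L2Sub τ (one_mem N)), inner_toL2, norm_toL2_sq,
      star_one, one_mul, hh]
    exact congrArg Complex.re (τ.tracial _ _)
  have hx' : ∀ a ∈ I, ‖rightMul τ y (toL2 τ a)‖ ^ 2
      ≤ C * ‖toL2 τ y‖ ^ 2 + ‖h‖ * ‖toL2 τ a - x‖ * (‖toL2 τ a‖ + ‖x‖) := fun a ha => by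
    have h1 : Tendsto (fun n => (⟪toL2 τ a, rightMul τ (s n * s n) (toL2 τ a)⟫_ℂ).re) atTop
        (𝓝 (‖rightMul τ y (toL2 τ a)‖ ^ 2)) := by
      have h2 := norm_rightMul_toL2_sq τ a y
      rw [inner_eq_inner_traceCondExp τ hind (toL2_mem_L2Sub τ (mul_mem (star_mem ha) ha)) hhJ]
        at h2
      rw [← Complex.ofReal_re (‖rightMul τ y (toL2 τ a)‖ ^ 2), h2]
      refine (Complex.continuous_re.tendsto _).comp
        ((tendsto_const_nhds.inner hlim).congr fun n => ?_)
      rw [rightMul_toL2, inner_toL2, inner_toL2, star_mul, star_star, mul_assoc]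
    have h3 : Tendsto (fun n => C * (⟪toL2 τ 1, toL2 τ (s n * s n)⟫_ℂ).re
        + ‖h‖ * ‖toL2 τ a - x‖ * (‖toL2 τ a‖ + ‖x‖)) atTop
        (𝓝 (C * ‖toL2 τ y‖ ^ 2 + ‖h‖ * ‖toL2 τ a - x‖ * (‖toL2 τ a‖ + ‖x‖))) := by
      rw [← hone]
      exact (((Complex.continuous_re.tendsto _).comp (tendsto_const_nhds.inner hlim)).const_mul
        C).add_const _
    exact le_of_tendsto_of_tendsto' h1 h3 fun n =>
      (hdiff _ n).trans (add_le_add_left (hbound n) _)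
  have := map_mem_of_mem_L2Sub τ (N := I) (Y := L2 τ) (s := {u | ‖rightMul τ y u‖ ^ 2
      ≤ C * ‖toL2 τ y‖ ^ 2 + ‖h‖ * ‖u - x‖ * (‖u‖ + ‖x‖)})
    (isClosed_le (by fun_prop) (by fun_prop)) continuous_id
    (fun a ha => Set.mem_ofPred.2 (hx' a ha)) hx
  simpa using this

/-- If right multiplication of `x` by elements of `J` is bounded in `‖·‖₂`, then the products `x y`
with `y ∈ L²(J, τ)` exist and are given by a bounded operator. -/
theorem exists_mulOperator {x : L2 τ} {C : ℝ} (hC0 : 0 ≤ C)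
    (hC : ∀ a ∈ J, ‖rightMul τ a x‖ ^ 2 ≤ C * ‖toL2 τ a‖ ^ 2) :
    ∃ M : L2 τ →L[ℂ] L2 τ, (∀ y ∈ L2Sub τ J, IsMul τ x y (M y)) ∧
      (∀ y, ‖M y‖ ^ 2 ≤ C * ‖y‖ ^ 2) := by
  have hC' : ∀ a ∈ J, ‖rightMul τ a x‖ ≤ √C * ‖toL2 τ a‖ := fun a ha => by
    refine abs_le_of_sq_le_sq' ?_ (by positivity) |>.2
    rw [mul_pow, Real.sq_sqrt hC0]; exact hC a ha
  have hex : ∀ y : L2Sub τ J, ∃ z, IsMul τ x y z ∧ ‖z‖ ≤ √C * ‖(y : L2 τ)‖ := fun y => by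
    obtain ⟨a, haJ, ha⟩ := exists_seq_of_mem_L2Sub τ y.2
    have hcau : CauchySeq fun n => rightMul τ (a n) x := by
      refine Metric.cauchySeq_iff.2 fun ε hε => ?_
      obtain ⟨K, hK⟩ := Metric.cauchySeq_iff.1 ha.cauchySeq (ε / (√C + 1)) (by positivity)
      refine ⟨K, fun m hm n hn => ?_⟩
      have h1 : rightMul τ (a m) x - rightMul τ (a n) x = rightMul τ (a m - a n) x := by
        rw [sub_eq_iff_eq_add, ← rightMul_add_apply, sub_add_cancel]
      have h2 := hK m hm n hn
      rw [dist_eq_norm, lt_div_iff₀ (by positivity), ← toL2_sub] at h2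
      rw [dist_eq_norm, h1]
      have := hC' _ (sub_mem (haJ m) (haJ n))
      nlinarith [norm_nonneg (toL2 τ (a m - a n))]
    obtain ⟨z, hz⟩ := cauchySeq_tendsto_of_complete hcau
    refine ⟨z, IsMul.of_tendsto (fun n => (isMul_toL2_iff τ x _ (a n)).2 rfl) ha hz, ?_⟩
    exact le_of_tendsto_of_tendsto' hz.norm (ha.norm.const_mul _) fun n => hC' _ (haJ n)
  choose F hF hFn using hex
  let L : L2Sub τ J →L[ℂ] L2 τ := LinearMap.mkContinuous
    { toFun := F
      map_add' := fun y y' => (hF _).unique ((hF y).add_right (hF y'))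
      map_smul' := fun c y => (hF _).unique ((hF y).smul_right c) } (√C) hFn
  refine ⟨L ∘L (L2Sub τ J).orthogonalProjectionOnto, fun y hy => ?_, fun y => ?_⟩
  · have h1 := hF ⟨y, hy⟩
    rw [ContinuousLinearMap.comp_apply,
      Submodule.orthogonalProjectionOnto_mem_subspace_eq_self (K := L2Sub τ J) ⟨y, hy⟩]
    exact h1
  · have h1 : ‖(L ∘L (L2Sub τ J).orthogonalProjectionOnto) y‖ ≤ √C * ‖y‖ :=
      (hFn _).trans (mul_le_mul_of_nonneg_left
        (Submodule.norm_orthogonalProjectionOnto_apply_le _ y) (by positivity))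
    calc _ ≤ (√C * ‖y‖) ^ 2 := pow_le_pow_left₀ (norm_nonneg _) h1 2
      _ = _ := by rw [mul_pow, Real.sq_sqrt hC0]

end Independence

section Cocycles

variable {A X : Type*} [CStarAlgebra A] [PartialOrder A] [StarOrderedRing A]
  [NormedAddCommGroup X] [NormedSpace ℂ X] {e : StrongDual ℂ X ≃ₗᵢ[ℂ] A} {τ : TracialState e}

/-! ### Automorphisms and the shift on `L²(A, τ)` -/

theorem ProbAut.onL2_toL2 (S : ProbAut τ) (a : A) : S.onL2 (toL2 τ a) = toL2 τ (S.toEquiv a) := by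
  simp only [ProbAut.onL2, toL2]
  rw [ContinuousLinearMap.completion_apply_coe]
  rfl

theorem ProbAut.inner_onL2 (S : ProbAut τ) (x y : L2 τ) : ⟪S.onL2 x, S.onL2 y⟫_ℂ = ⟪x, y⟫_ℂ := by
  refine L2_ext τ (f := fun x => ⟪S.onL2 x, S.onL2 y⟫_ℂ) (g := fun x => ⟪x, y⟫_ℂ)
    (by fun_prop) (by fun_prop) (fun a => ?_) x
  refine L2_ext τ (f := fun y => ⟪S.onL2 (toL2 τ a), S.onL2 y⟫_ℂ) (g := fun y => ⟪toL2 τ a, y⟫_ℂ)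
    (by fun_prop) (by fun_prop) (fun b => ?_) y
  simp only [ProbAut.onL2_toL2, inner_toL2]
  rw [← map_star, ← map_mul, S.trace_map]

theorem ProbAut.norm_onL2 (S : ProbAut τ) (x : L2 τ) : ‖S.onL2 x‖ = ‖x‖ := by
  rw [norm_eq_sqrt_re_inner (𝕜 := ℂ), S.inner_onL2, ← norm_eq_sqrt_re_inner]

theorem ProbAut.onL2_rightMul (S : ProbAut τ) (a : A) (x : L2 τ) :
    S.onL2 (rightMul τ a x) = rightMul τ (S.toEquiv a) (S.onL2 x) :=
  L2_ext τ (f := fun x => S.onL2 (rightMul τ a x))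
    (g := fun x => rightMul τ (S.toEquiv a) (S.onL2 x)) (by fun_prop) (by fun_prop)
    (fun b => by simp only [rightMul_toL2, S.onL2_toL2, map_mul]) x

namespace WhiteNoise

variable (W : WhiteNoise τ)

theorem onL2_shift_of_mem {x : L2 τ} (hx : x ∈ L2Sub τ W.alg₀) (t : ℝ) :
    (W.shift t).onL2 x = x :=
  map_mem_of_mem_L2Sub τ (isClosed_eq (W.shift t).onL2.continuous continuous_id) continuous_id
    (fun a ha => Set.mem_ofPred.2 (by
      simp only [id, ProbAut.onL2_toL2, (W.mem_alg₀_iff a).1 ha t])) hx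

theorem onL2_shift_rightMul {a : A} (ha : a ∈ W.alg₀) (t : ℝ) (x : L2 τ) :
    (W.shift t).onL2 (rightMul τ a x) = rightMul τ a ((W.shift t).onL2 x) := by
  rw [ProbAut.onL2_rightMul, (W.mem_alg₀_iff a).1 ha t]

theorem onL2_shift_mem {s t : EReal} (hst : s ≤ t) (r : ℝ) {x : L2 τ}
    (hx : x ∈ L2Sub τ (W.alg s t)) : (W.shift r).onL2 x ∈ L2Sub τ (W.alg (s + r) (t + r)) := by
  refine map_mem_of_mem_L2Sub τ (isClosed_L2Sub τ _) (W.shift r).onL2.continuous (fun a ha => ?_) hx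
  rw [ProbAut.onL2_toL2]
  refine toL2_mem_L2Sub τ ?_
  rw [← SetLike.mem_coe, ← W.compatible s t r hst]
  exact ⟨a, ha, rfl⟩

theorem E₀_mem (x : L2 τ) : W.E₀ x ∈ L2Sub τ W.alg₀ := traceCondExp_mem τ _ x

theorem E₀_onL2_shift (t : ℝ) (x : L2 τ) : W.E₀ ((W.shift t).onL2 x) = W.E₀ x := by
  refine traceCondExp_eq_of_inner τ (W.E₀_mem x) fun a ha => ?_
  have h := toL2_mem_L2Sub τ ha
  conv_lhs => rw [← W.onL2_shift_of_mem h t]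
  rw [ProbAut.inner_onL2]
  exact (inner_traceCondExp_of_mem τ h x).symm

theorem alg_le_alg {p q r : EReal} (hpq : p ≤ q) (hqr : q ≤ r) : W.alg p q ≤ W.alg p r := by
  have h := W.alg_union p q q r p r hpq hqr (hpq.trans hqr) (Set.Icc_union_Icc_eq_Icc hpq hqr)
  exact fun a ha => h.1.2 (Or.inl ha)

theorem adaptedSpace_mono {s t : ℝ} (hs : 0 ≤ s) (hst : s ≤ t) :
    W.adaptedSpace s ≤ W.adaptedSpace t :=
  L2Sub_mono τ (W.alg_le_alg (by exact_mod_cast hs) (by exact_mod_cast hst))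

theorem L2Sub_alg₀_le_adaptedSpace {t : ℝ} (ht : 0 ≤ t) : L2Sub τ W.alg₀ ≤ W.adaptedSpace t :=
  L2Sub_mono τ (W.alg₀_le _ _ (by exact_mod_cast ht))

/-- The past up to time `s` and the algebra of `[s, t]` are independent over `A₀`. -/
theorem independent_adjacent {s t : ℝ} (hs : 0 ≤ s) (hst : s ≤ t) :
    traceCondExp τ (W.alg s t) ∘L traceCondExp τ (W.alg 0 s) = traceCondExp τ W.alg₀ ∧
    traceCondExp τ (W.alg 0 s) ∘L traceCondExp τ (W.alg s t) = traceCondExp τ W.alg₀ := by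
  have h0 : (0 : EReal) ≤ s := by exact_mod_cast hs
  have h1 : (s : EReal) ≤ t := by exact_mod_cast hst
  have hd : Disjoint (Set.Ioo (0 : EReal) s) (Set.Ioo (s : EReal) t) :=
    Set.disjoint_left.2 fun x hx hx' => lt_asymm hx.2 hx'.1
  exact ⟨W.independent _ _ _ _ h1 h0 hd.symm, W.independent _ _ _ _ h0 h1 hd⟩

/-! ### Cocycles with bounded covariance -/

/-- Over `A₀`, the decomposition of `x` into centred part and expectation is orthogonal, also after
multiplication with elements of `A₀`. -/
theorem norm_rightMul_sq_eq (x : L2 τ) {a : A} (ha : a ∈ W.alg₀) : ‖rightMul τ a x‖ ^ 2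
    = ‖rightMul τ a (x - W.E₀ x)‖ ^ 2 + ‖rightMul τ a (W.E₀ x)‖ ^ 2 := by
  have h : ⟪rightMul τ a (x - W.E₀ x), rightMul τ a (W.E₀ x)⟫_ℂ = 0 := by
    rw [← inner_conj_symm, ← star_star a, ← inner_rightMul]
    have h1 : rightMul τ (star a) (rightMul τ (star (star a)) (W.E₀ x)) ∈ L2Sub τ W.alg₀ :=
      rightMul_mem_L2Sub τ (star_mem ha) (rightMul_mem_L2Sub τ (by simpa using ha) (W.E₀_mem x))
    rw [inner_sub_right, ← inner_traceCondExp_of_mem τ h1 x, WhiteNoise.E₀, sub_self, map_zero]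
  have h2 := norm_add_sq_eq_norm_sq_add_norm_sq_of_inner_eq_zero _ _ h
  rw [← map_add, sub_add_cancel] at h2
  simpa [sq] using h2

/-- If `E_N(x* x) = k`, then `‖x a‖₂² = τ(a* k a) ≤ ‖k‖ ‖a‖₂²` for `a ∈ N`. -/
theorem _root_.NCWhiteNoise.IsCondExpAbsSq.norm_rightMul_sq_le {N : StarSubalgebra ℂ A} {x : L2 τ}
    {k : A} (h : IsCondExpAbsSq τ N x k) {a : A} (ha : a ∈ N) :
    ‖rightMul τ a x‖ ^ 2 ≤ ‖k‖ * ‖toL2 τ a‖ ^ 2 := by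
  have h1 : ⟪rightMul τ a x, rightMul τ a x⟫_ℂ = ⟪toL2 τ a, leftMul τ k (toL2 τ a)⟫_ℂ := by
    rw [rightMul_apply, inner_adj_adj, inner_leftMul, star_star, ← leftMul_mul_apply,
      h.2 _ (mul_mem ha (star_mem ha)), leftMul_toL2, inner_toL2, ← mul_assoc]
    exact τ.tracial _ _
  rw [norm_sq_eq_re_inner (𝕜 := ℂ), h1]
  calc _ ≤ ‖toL2 τ a‖ * ‖leftMul τ k (toL2 τ a)‖ :=
        (Complex.re_le_norm _).trans (norm_inner_le_norm _ _)
    _ ≤ ‖toL2 τ a‖ * (‖k‖ * ‖toL2 τ a‖) := by gcongr; exact norm_leftMul_apply_le τ _ _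
    _ = _ := by ring

variable {W} {b : ℝ → L2 τ}

theorem IsAdditiveCocycle.centredPart_add (hb : W.IsAdditiveCocycle b) {s t : ℝ} (hs : 0 ≤ s)
    (ht : 0 ≤ t) : W.centredPart b (s + t)
      = (W.shift t).onL2 (W.centredPart b s) + W.centredPart b t := by
  simp only [centredPart, hb.cocycle s t hs ht, map_add, map_sub, E₀_onL2_shift,
    W.onL2_shift_of_mem (W.E₀_mem _)]
  abel

theorem IsAdditiveCocycle.centredPart_mem (hb : W.IsAdditiveCocycle b) {t : ℝ} (ht : 0 ≤ t) :
    W.centredPart b t ∈ W.adaptedSpace t :=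
  Submodule.sub_mem _ (hb.adapted t ht) (W.L2Sub_alg₀_le_adaptedSpace ht (W.E₀_mem _))

variable (W b) in
theorem E₀_centredPart (t : ℝ) : W.E₀ (W.centredPart b t) = 0 := by
  rw [centredPart, map_sub, sub_eq_zero]
  exact (traceCondExp_of_mem τ (W.E₀_mem (b t))).symm

theorem IsAdditiveCocycle.onL2_centredPart_mem (hb : W.IsAdditiveCocycle b) {h s : ℝ}
    (hh : 0 ≤ h) : (W.shift s).onL2 (W.centredPart b h)
      ∈ L2Sub τ (W.alg s ((h + s : ℝ) : EReal)) := by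
  have := W.onL2_shift_mem (by exact_mod_cast hh) s (hb.centredPart_mem hh)
  simpa using this

/-- `a ↦ ‖c_t a‖₂²` is additive in `t`, because the increments of `c` are independent and
centred. -/
theorem IsAdditiveCocycle.norm_rightMul_centredPart_add (hb : W.IsAdditiveCocycle b) {s t : ℝ}
    (hs : 0 ≤ s) (ht : 0 ≤ t) {a : A} (ha : a ∈ W.alg₀) :
    ‖rightMul τ a (W.centredPart b (s + t))‖ ^ 2
      = ‖rightMul τ a (W.centredPart b s)‖ ^ 2 + ‖rightMul τ a (W.centredPart b t)‖ ^ 2 := by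
  have ha' : a ∈ W.alg 0 t := W.alg₀_le _ _ (by exact_mod_cast ht) ha
  have h : ⟪rightMul τ a (W.centredPart b t),
      rightMul τ a ((W.shift t).onL2 (W.centredPart b s))⟫_ℂ = 0 :=
    inner_rightMul_eq_zero τ (W.independent_adjacent ht (by linarith : t ≤ s + t)).2
      (hb.onL2_centredPart_mem hs)
      (by rw [← E₀_centredPart W b s, ← W.E₀_onL2_shift t]; rfl)
      (rightMul_mem_L2Sub τ ha' (hb.centredPart_mem ht)) ha'
  rw [hb.centredPart_add hs ht, map_add, add_comm (rightMul τ a _)]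
  have h2 := norm_add_sq_eq_norm_sq_add_norm_sq_of_inner_eq_zero _ _ h
  rw [← W.onL2_shift_rightMul ha, ProbAut.norm_onL2] at h2
  rw [← W.onL2_shift_rightMul ha]
  linarith

theorem IsAdditiveCocycle.norm_rightMul_centredPart_le (hb : W.IsAdditiveCocycle b) {k : A}
    (hk : IsCondExpAbsSq τ W.alg₀ (b 1) k) {t : ℝ} (ht : 0 ≤ t) {a : A} (ha : a ∈ W.alg₀) :
    ‖rightMul τ a (W.centredPart b t)‖ ^ 2 ≤ ‖k‖ * t * ‖toL2 τ a‖ ^ 2 := by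
  set q : ℝ → ℝ := fun t => ‖rightMul τ a (W.centredPart b t)‖ ^ 2 with hq
  have hadd : ∀ s t, 0 ≤ s → 0 ≤ t → q (s + t) = q s + q t := fun s t hs ht =>
    hb.norm_rightMul_centredPart_add hs ht ha
  have hpos : ∀ t, 0 ≤ q t := fun t => sq_nonneg _
  have hq1 : q 1 ≤ ‖k‖ * ‖toL2 τ a‖ ^ 2 := by
    have h1 := W.norm_rightMul_sq_eq (b 1) ha
    have h2 := hk.norm_rightMul_sq_le ha
    have h3 : q 1 = ‖rightMul τ a (b 1 - W.E₀ (b 1))‖ ^ 2 := rfl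
    nlinarith [sq_nonneg ‖rightMul τ a (W.E₀ (b 1))‖]
  have hq0 : q 0 = 0 := by simpa using hadd 0 0 le_rfl le_rfl
  have hnat : ∀ (n : ℕ) (s : ℝ), 0 ≤ s → q (n * s) = n * q s := fun n s hs => by
    induction n with
    | zero => simp [hq0]
    | succ n ih =>
      rw [Nat.cast_succ, add_mul, one_mul, hadd _ _ (by positivity) hs, ih]; ring
  -- Monotonicity compares `q t` with `q (m / n) = (m / n) q 1` for `m / n` slightly above `t`.
  have hstep : ∀ n : ℕ, q t ≤ (t + 1 / ((n : ℝ) + 1)) * q 1 := fun n => by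
    set m := ⌈((n : ℝ) + 1) * t⌉₊
    have hn : (0 : ℝ) < n + 1 := by positivity
    have h1 : t ≤ m * (1 / ((n : ℝ) + 1)) := by
      rw [mul_one_div, le_div_iff₀ hn, mul_comm]; exact Nat.le_ceil _
    have h2 : (m : ℝ) * (1 / ((n : ℝ) + 1)) ≤ t + 1 / ((n : ℝ) + 1) := by
      rw [mul_one_div, div_le_iff₀ hn, add_mul, one_div_mul_cancel hn.ne', mul_comm t]
      exact (Nat.ceil_lt_add_one (by positivity)).le
    have h3 : q 1 = (n + 1) * q (1 / ((n : ℝ) + 1)) := by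
      have := hnat (n + 1) (1 / ((n : ℝ) + 1)) (by positivity)
      rw [Nat.cast_succ, mul_one_div_cancel hn.ne'] at this
      exact this
    have h4 : q t ≤ q (m * (1 / ((n : ℝ) + 1))) := by
      rw [← sub_add_cancel ((m : ℝ) * (1 / ((n : ℝ) + 1))) t, hadd _ _ (by linarith) ht]
      linarith [hpos ((m : ℝ) * (1 / ((n : ℝ) + 1)) - t)]
    calc q t ≤ m * q (1 / ((n : ℝ) + 1)) := by rw [← hnat m _ (by positivity)]; exact h4
      _ = m * (1 / ((n : ℝ) + 1)) * q 1 := by rw [h3]; field_simp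
      _ ≤ _ := mul_le_mul_of_nonneg_right h2 (hpos 1)
  have hlim : Tendsto (fun n : ℕ => (t + 1 / ((n : ℝ) + 1)) * q 1) atTop (𝓝 ((t + 0) * q 1)) :=
    (tendsto_one_div_add_atTop_nhds_zero_nat.const_add t).mul_const _
  have h := ge_of_tendsto' hlim hstep
  rw [add_zero] at h
  calc q t ≤ t * q 1 := h
    _ ≤ t * (‖k‖ * ‖toL2 τ a‖ ^ 2) := by gcongr
    _ = _ := by ring

/-- Left multiplication by an increment `c_t - c_s` as a bounded operator on the past
`L²(A_{[0,s]}, τ)`. -/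
theorem IsAdditiveCocycle.exists_increment_operator (hb : W.IsAdditiveCocycle b) {k : A}
    (hk : IsCondExpAbsSq τ W.alg₀ (b 1) k) {s t : ℝ} (hs : 0 ≤ s) (hst : s ≤ t) :
    ∃ M : L2 τ →L[ℂ] L2 τ,
      (∀ y ∈ W.adaptedSpace s, IsMul τ (W.centredPart b t - W.centredPart b s) y (M y)) ∧
      (∀ y, ‖M y‖ ^ 2 ≤ ‖k‖ * (t - s) * ‖y‖ ^ 2) ∧
      (∀ y ∈ W.adaptedSpace s, M y ∈ W.adaptedSpace t) ∧
      ∀ y ∈ W.adaptedSpace s, ∀ w ∈ W.adaptedSpace s, ⟪w, M y⟫_ℂ = 0 := by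
  set x := W.centredPart b t - W.centredPart b s with hx_def
  have hx : x = (W.shift s).onL2 (W.centredPart b (t - s)) := by
    have := hb.centredPart_add (sub_nonneg.2 hst) hs
    rw [sub_add_cancel] at this
    rw [hx_def, this, add_sub_cancel_right]
  have hxI : x ∈ L2Sub τ (W.alg s t) := by
    have := hb.onL2_centredPart_mem (s := s) (sub_nonneg.2 hst)
    rwa [sub_add_cancel, ← hx] at this
  have hx0 : traceCondExp τ W.alg₀ x = 0 := by
    rw [hx, ← E₀_centredPart W b (t - s), ← W.E₀_onL2_shift s]; rfl
  have hxt : x ∈ W.adaptedSpace t :=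
    sub_mem (hb.centredPart_mem (hs.trans hst))
      (W.adaptedSpace_mono hs hst (hb.centredPart_mem hs))
  have hind := W.independent_adjacent hs hst
  have hbound : ∀ a ∈ W.alg 0 s, ‖rightMul τ a x‖ ^ 2 ≤ ‖k‖ * (t - s) * ‖toL2 τ a‖ ^ 2 :=
    fun a ha => norm_rightMul_sq_le_of_independent τ W.isVN_alg₀.isClosed hind.1 hxI
      (fun a ha => by
        rw [hx, ← W.onL2_shift_rightMul ha, ProbAut.norm_onL2]
        exact hb.norm_rightMul_centredPart_le hk (sub_nonneg.2 hst) ha) ha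
  obtain ⟨M, hM, hMn⟩ := exists_mulOperator τ
    (mul_nonneg (norm_nonneg k) (sub_nonneg.2 hst)) hbound
  have hMa : ∀ a ∈ W.alg 0 s, M (toL2 τ a) = rightMul τ a x := fun a ha =>
    (isMul_toL2_iff τ _ _ _).1 (hM _ (toL2_mem_L2Sub τ ha))
  have hle : W.alg 0 s ≤ W.alg 0 t :=
    W.alg_le_alg (by exact_mod_cast hs) (by exact_mod_cast hst)
  refine ⟨M, hM, hMn, fun y hy => ?_, fun y hy w hw => ?_⟩
  · refine map_mem_of_mem_L2Sub τ (isClosed_L2Sub τ (W.alg 0 t)) M.continuous (fun a ha => ?_) hy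
    rw [hMa a ha]
    exact rightMul_mem_L2Sub τ (hle ha) hxt
  · refine map_mem_of_mem_L2Sub τ (s := {0}) (isClosed_singleton)
      (f := fun y => ⟪w, M y⟫_ℂ) (by fun_prop) (fun a ha => ?_) hy
    rw [hMa a ha]
    exact inner_rightMul_eq_zero τ hind.2 hxI hx0 hw ha

/-- Left multiplication by the drift coefficient `d` as a bounded operator. -/
theorem exists_drift_operator {k : A} (hk : IsCondExpAbsSq τ W.alg₀ (b 1) k) :
    ∃ D : L2 τ →L[ℂ] L2 τ, ∀ t, 0 ≤ t → ∀ y ∈ W.adaptedSpace t,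
      IsMul τ (W.driftCoeff b) y (D y) ∧ D y ∈ W.adaptedSpace t := by
  have hd : ∀ a ∈ W.alg₀, ‖rightMul τ a (W.driftCoeff b)‖ ^ 2 ≤ ‖k‖ * ‖toL2 τ a‖ ^ 2 :=
    fun a ha => by
      have h1 := W.norm_rightMul_sq_eq (b 1) ha
      have h2 := hk.norm_rightMul_sq_le ha
      rw [driftCoeff]
      nlinarith [sq_nonneg ‖rightMul τ a (b 1 - W.E₀ (b 1))‖]
  have hd0 : W.driftCoeff b ∈ L2Sub τ W.alg₀ := W.E₀_mem _
  -- The interval `[0, 0]` has empty interior, so its algebra is independent of every other one.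
  have hind : traceCondExp τ (W.alg 0 0) ∘L traceCondExp τ (W.alg 0 ⊤) = traceCondExp τ W.alg₀ :=
    W.independent 0 0 0 ⊤ le_rfl le_top (by simp)
  obtain ⟨D, hD, -⟩ := exists_mulOperator τ (norm_nonneg k) (J := W.alg 0 ⊤) fun a ha =>
    norm_rightMul_sq_le_of_independent τ W.isVN_alg₀.isClosed hind
      (L2Sub_mono τ (W.alg₀_le _ _ le_rfl) hd0) hd ha
  have hle : ∀ t : ℝ, 0 ≤ t → W.alg 0 t ≤ W.alg 0 ⊤ := fun t ht =>
    W.alg_le_alg (by exact_mod_cast ht) le_top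
  refine ⟨D, fun t ht y hy => ⟨hD y (L2Sub_mono τ (hle t ht) hy), ?_⟩⟩
  refine map_mem_of_mem_L2Sub τ (isClosed_L2Sub τ (W.alg 0 t)) D.continuous (fun a ha => ?_) hy
  rw [(isMul_toL2_iff τ _ _ _).1 (hD _ (toL2_mem_L2Sub τ (hle t ht ha)))]
  exact rightMul_mem_L2Sub τ ha (W.L2Sub_alg₀_le_adaptedSpace ht hd0)

end WhiteNoise

end Cocycles

/-! ### Step functions in `L²(ℝ; H)` -/

section StepFunctions

variable {H : Type*} [NormedAddCommGroup H]

/-- The class of `y χ_{[s, t)}` in `L²(ℝ; H)`. -/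
noncomputable def stepLp (s t : ℝ) (y : H) : Lp H 2 (volume : Measure ℝ) :=
  indicatorConstLp 2 (measurableSet_Ico (a := s) (b := t)) measure_Ico_lt_top.ne y

theorem stepLp_coeFn (s t : ℝ) (y : H) :
    stepLp s t y =ᵐ[volume] (Set.Ico s t).indicator fun _ => y := indicatorConstLp_coeFn

theorem stepLp_add (s t : ℝ) (y z : H) : stepLp s t (y + z) = stepLp s t y + stepLp s t z :=
  indicatorConstLp_add.symm

theorem stepLp_self (s : ℝ) (y : H) : stepLp s s y = 0 := by
  ext1
  filter_upwards [stepLp_coeFn s s y, Lp.coeFn_zero H 2 (volume : Measure ℝ)] with r h1 h2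
  rw [h1, h2]; simp

theorem stepLp_zero (s t : ℝ) : stepLp s t (0 : H) = 0 := by
  simpa using stepLp_add s t (0 : H) 0

theorem stepLp_add_stepLp {s t u : ℝ} (hst : s ≤ t) (htu : t ≤ u) (y : H) :
    stepLp s t y + stepLp t u y = stepLp s u y := by
  ext1
  filter_upwards [stepLp_coeFn s t y, stepLp_coeFn t u y, stepLp_coeFn s u y,
    Lp.coeFn_add (stepLp s t y) (stepLp t u y)] with r h1 h2 h3 h4
  rw [h4, Pi.add_apply, h1, h2, h3, ← Set.Ico_union_Ico_eq_Ico hst htu,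
    Set.indicator_union_of_disjoint (Set.Ico_disjoint_Ico_same)]

theorem norm_stepLp_sq {s t : ℝ} (hst : s ≤ t) (y : H) :
    ‖stepLp s t y‖ ^ 2 = (t - s) * ‖y‖ ^ 2 := by
  have h : volume.real (Set.Ico s t) = t - s := Real.volume_real_Ico_of_le hst
  rw [stepLp, norm_indicatorConstLp (by simp) (by simp), mul_pow, h, mul_comm]
  congr 1
  rw [← Real.rpow_natCast, ← Real.rpow_mul (sub_nonneg.2 hst)]
  simp

theorem sum_stepLp_coeFn (u : ℕ → ℝ) (v : ℕ → H) (n : ℕ) :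
    (∑ k ∈ Finset.range n, stepLp (u k) (u (k + 1)) (v k) : Lp H 2 (volume : Measure ℝ))
      =ᵐ[volume] fun r => ∑ k ∈ Finset.range n,
        (Set.Ico (u k) (u (k + 1))).indicator (fun _ => v k) r := by
  induction n with
  | zero =>
    simp only [Finset.range_zero, Finset.sum_empty]
    exact Lp.coeFn_zero H 2 _
  | succ n ih =>
    rw [Finset.sum_range_succ]
    filter_upwards [ih, stepLp_coeFn (u n) (u (n + 1)) (v n), Lp.coeFn_add
      (∑ k ∈ Finset.range n, stepLp (u k) (u (k + 1)) (v k)) (stepLp (u n) (u (n + 1)) (v n))]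
      with r h1 h2 h3
    rw [h3, Pi.add_apply, h1, h2, Finset.sum_range_succ]

/-- For a simple process with nodes in `[0, t]` the distances to `y` in `L²(ℝ; H)` and in
`L²([0, t]; H)` agree. -/
theorem eLpNorm_sum_stepLp_sub {t : ℝ} {u : ℕ → ℝ} {n : ℕ} {v : ℕ → H}
    (hu : ∀ k < n, 0 ≤ u k ∧ u (k + 1) ≤ t) (y : ℝ → H) :
    eLpNorm (⇑(∑ k ∈ Finset.range n, stepLp (u k) (u (k + 1)) (v k)) - (Set.Icc 0 t).indicator y)
      2 volume
      = eLpNorm (fun r => ∑ k ∈ Finset.range n,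
          (Set.Ico (u k) (u (k + 1))).indicator (fun _ => v k) r - y r) 2
        (volume.restrict (Set.Icc 0 t)) := by
  rw [← eLpNorm_indicator_eq_eLpNorm_restrict measurableSet_Icc]
  refine eLpNorm_congr_ae ?_
  filter_upwards [sum_stepLp_coeFn u v n] with r hr
  rw [Pi.sub_apply, hr]
  by_cases h : r ∈ Set.Icc 0 t
  · simp only [Set.indicator_of_mem h]
  · rw [Set.indicator_of_notMem h, Set.indicator_of_notMem h, sub_zero]
    refine Finset.sum_eq_zero fun k hk => Set.indicator_of_notMem (fun hr => h ?_) _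
    have hk' := hu k (Finset.mem_range.1 hk)
    exact Set.mem_Icc.2 ⟨hk'.1.trans hr.1, hr.2.le.trans hk'.2⟩

variable [InnerProductSpace ℂ H]

theorem stepLp_smul (s t : ℝ) (c : ℂ) (y : H) : stepLp s t (c • y) = c • stepLp s t y := by
  ext1
  filter_upwards [stepLp_coeFn s t (c • y), stepLp_coeFn s t y, Lp.coeFn_smul c (stepLp s t y)]
    with r h1 h2 h3
  rw [h1, h3, Pi.smul_apply, h2]
  by_cases hr : r ∈ Set.Ico s t <;> simp [hr]

theorem inner_stepLp_of_le {s t s' t' : ℝ} (h : t ≤ s') (y y' : H) :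
    ⟪stepLp s t y, stepLp s' t' y'⟫_ℂ = 0 := by
  rw [stepLp, L2.inner_indicatorConstLp_eq_setIntegral_inner]
  refine (setIntegral_congr_ae (g := fun _ => (0 : ℂ)) measurableSet_Ico ?_).trans
    (integral_zero _ _)
  filter_upwards [stepLp_coeFn s' t' y'] with r h1 hr
  rw [h1, Set.indicator_of_notMem (fun h' => absurd (h.trans h'.1) (not_le.2 hr.2))]
  simp

/-- The norm of a step function on a partition. -/
theorem norm_sum_stepLp_sq {u : ℕ → ℝ} (hu : Monotone u) (v : ℕ → H) (n : ℕ) :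
    ‖∑ k ∈ Finset.range n, stepLp (u k) (u (k + 1)) (v k)‖ ^ 2
      = ∑ k ∈ Finset.range n, (u (k + 1) - u k) * ‖v k‖ ^ 2 := by
  induction n with
  | zero => simp
  | succ n ih =>
    have h : ⟪∑ k ∈ Finset.range n, stepLp (u k) (u (k + 1)) (v k),
        stepLp (u n) (u (n + 1)) (v n)⟫_ℂ = 0 := by
      rw [sum_inner]
      exact Finset.sum_eq_zero fun k hk =>
        inner_stepLp_of_le (hu (Nat.succ_le_of_lt (Finset.mem_range.1 hk))) _ _
    have h2 := norm_add_sq_eq_norm_sq_add_norm_sq_of_inner_eq_zero _ _ h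
    rw [Finset.sum_range_succ, Finset.sum_range_succ, ← ih, sq, h2, ← sq, ← sq,
      norm_stepLp_sq (hu n.le_succ)]

end StepFunctions

/-- A finite set of reals is contained in the set of nodes of a partition. -/
theorem exists_monotone_nodes {F : Finset ℝ} (hF : ∀ x ∈ F, 0 ≤ x) :
    ∃ (u : ℕ → ℝ) (n : ℕ), Monotone u ∧ 0 ≤ u 0 ∧ ∀ x ∈ F, ∃ k ≤ n, u k = x := by
  rcases F.eq_empty_or_nonempty with rfl | hne
  · exact ⟨fun _ => 0, 0, monotone_const, le_rfl, by simp⟩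
  have hc : F.card = F.card - 1 + 1 := (Nat.succ_pred_eq_of_pos hne.card_pos).symm
  set n := F.card - 1
  refine ⟨fun k => F.orderEmbOfFin hc ⟨min k n, by omega⟩, n, fun i j hij => ?_, ?_, fun x hx => ?_⟩
  · refine (F.orderEmbOfFin hc).monotone ?_
    rw [Fin.mk_le_mk]; omega
  · exact hF _ (F.orderEmbOfFin_mem hc _)
  · have : x ∈ Set.range (F.orderEmbOfFin hc) := by rw [F.range_orderEmbOfFin]; exact hx
    obtain ⟨i, rfl⟩ := this
    have hi : (i : ℕ) ≤ n := Nat.lt_succ_iff.1 i.2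
    exact ⟨i, hi, by simp [min_eq_left hi]⟩

/-! ### The graph of the Itô integral -/

/-- What Itô integration in a Hilbert space uses of an operator valued process with centred
independent increments: a filtration `past t` of closed subspaces for `t ≥ 0`, and operators
`incr s t`, the action of the increment over `[s, t]` on `past s`. The increments are additive, take
values in `past t` orthogonal to `past s`, and their square is bounded by a multiple of `t - s`. -/
structure ItoSystem (H : Type*) [NormedAddCommGroup H] [InnerProductSpace ℂ H] where
  /-- the filtration -/
  past : ℝ → Submodule ℂ H
  isClosed_past : ∀ t, IsClosed (past t : Set H)
  past_mono : ∀ ⦃s t⦄, 0 ≤ s → s ≤ t → past s ≤ past t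
  /-- the operators of the increments -/
  incr : ℝ → ℝ → H →L[ℂ] H
  /-- the variance per unit of time -/
  const : ℝ
  const_nonneg : 0 ≤ const
  incr_mem : ∀ ⦃s t⦄, 0 ≤ s → s ≤ t → ∀ y ∈ past s, incr s t y ∈ past t
  norm_incr_sq_le : ∀ ⦃s t⦄, 0 ≤ s → s ≤ t → ∀ y ∈ past s,
    ‖incr s t y‖ ^ 2 ≤ const * ((t - s) * ‖y‖ ^ 2)
  inner_incr : ∀ ⦃s t⦄, 0 ≤ s → s ≤ t → ∀ y ∈ past s, ∀ w ∈ past s, ⟪w, incr s t y⟫_ℂ = 0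
  incr_add : ∀ ⦃s t u⦄, 0 ≤ s → s ≤ t → t ≤ u → ∀ y ∈ past s,
    incr s t y + incr t u y = incr s u y

namespace ItoSystem

variable {H : Type*} [NormedAddCommGroup H] [InnerProductSpace ℂ H] (S : ItoSystem H)

theorem incr_self {s : ℝ} (hs : 0 ≤ s) {y : H} (hy : y ∈ S.past s) : S.incr s s y = 0 := by
  simpa using S.incr_add hs le_rfl le_rfl y hy

/-- Pairs of a simple adapted process and its Itô integral: the span of
`(y χ_{[s, t)}, (c_t - c_s) y)` with `y` in the past of `s`. -/
noncomputable def simpleGraph : Submodule ℂ (Lp H 2 (volume : Measure ℝ) × H) :=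
  Submodule.span ℂ {p | ∃ s t y, 0 ≤ s ∧ s ≤ t ∧ y ∈ S.past s ∧ p = (stepLp s t y, S.incr s t y)}

/-- The graph of the Itô integral as an operator from `L²(ℝ; H)` to `H`. -/
noncomputable def itoGraph : Submodule ℂ (Lp H 2 (volume : Measure ℝ) × H) := S.simpleGraph.topologicalClosure

variable {S}

theorem sum_mem_itoGraph {u : ℕ → ℝ} {n : ℕ} {v : ℕ → H} (hu : ∀ k < n, u k ≤ u (k + 1))
    (h0 : ∀ k < n, 0 ≤ u k) (hv : ∀ k < n, v k ∈ S.past (u k)) :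
    (∑ k ∈ Finset.range n, stepLp (u k) (u (k + 1)) (v k),
      ∑ k ∈ Finset.range n, S.incr (u k) (u (k + 1)) (v k)) ∈ S.itoGraph := by
  refine Submodule.le_topologicalClosure _ ?_
  have h : (∑ k ∈ Finset.range n, stepLp (u k) (u (k + 1)) (v k),
      ∑ k ∈ Finset.range n, S.incr (u k) (u (k + 1)) (v k))
      = ∑ k ∈ Finset.range n,
        (stepLp (u k) (u (k + 1)) (v k), S.incr (u k) (u (k + 1)) (v k)) := by
    ext1 <;> simp [Prod.fst_sum, Prod.snd_sum]
  rw [h]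
  refine Submodule.sum_mem _ fun k hk => Submodule.subset_span ?_
  have hk' := Finset.mem_range.1 hk
  exact ⟨_, _, _, h0 k hk', hu k hk', hv k hk', rfl⟩

/-- `f_{a,b} = ∑ f_{k,k+1}` for an additive interval function, with the sum written over a larger
range. -/
theorem sum_ite_eq_of_additive {E : Type*} [AddCommMonoid E] {f : ℕ → ℕ → E} {a b n : ℕ}
    (hab : a ≤ b) (hbn : b ≤ n) (h0 : f a a = 0)
    (hadd : ∀ k, a ≤ k → f a k + f k (k + 1) = f a (k + 1)) :
    ∑ k ∈ Finset.range n, (if a ≤ k ∧ k < b then f k (k + 1) else 0) = f a b := by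
  rw [← Finset.sum_filter]
  have h1 : (Finset.range n).filter (fun k => a ≤ k ∧ k < b) = Finset.Ico a b := by
    ext k; simp only [Finset.mem_filter, Finset.mem_range, Finset.mem_Ico]; omega
  rw [h1]
  induction b, hab using Nat.le_induction with
  | base => simp [h0]
  | succ k hk ih =>
    rw [Finset.sum_Ico_succ_top hk, ih (by omega) (by
      ext k; simp only [Finset.mem_filter, Finset.mem_range, Finset.mem_Ico]; omega), hadd k hk]

/-- Every element of the simple graph is given on all sufficiently fine partitions. This makes it
possible to add simple processes. -/
theorem exists_nodes_of_mem_simpleGraph {p : Lp H 2 (volume : Measure ℝ) × H}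
    (hp : p ∈ S.simpleGraph) : ∃ F : Finset ℝ, (∀ x ∈ F, 0 ≤ x) ∧
      ∀ (u : ℕ → ℝ) (n : ℕ), Monotone u → 0 ≤ u 0 → (∀ x ∈ F, ∃ k ≤ n, u k = x) →
      ∃ v : ℕ → H, (∀ k, v k ∈ S.past (u k)) ∧
        p.1 = ∑ k ∈ Finset.range n, stepLp (u k) (u (k + 1)) (v k) ∧
        p.2 = ∑ k ∈ Finset.range n, S.incr (u k) (u (k + 1)) (v k) := by
  induction hp using Submodule.span_induction with
  | mem p hp =>
    obtain ⟨s, t, y, hs, hst, hy, rfl⟩ := hp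
    refine ⟨{s, t}, by simp [hs, hs.trans hst], fun u n hu h0 hF => ?_⟩
    obtain ⟨a, ha, rfl⟩ := hF s (by simp)
    obtain ⟨b, hb, rfl⟩ := hF t (by simp)
    have hpos : ∀ k, 0 ≤ u k := fun k => h0.trans (hu k.zero_le)
    rcases le_or_gt a b with hab | hab
    · refine ⟨fun k => if a ≤ k ∧ k < b then y else 0, fun k => ?_, ?_, ?_⟩
      · dsimp only
        split_ifs with hk
        · exact S.past_mono (hpos a) (hu hk.1) hy
        · exact Submodule.zero_mem _
      · dsimp only
        rw [← sum_ite_eq_of_additive (f := fun i j => stepLp (u i) (u j) y) hab hb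
          (stepLp_self _ _) fun k hk => stepLp_add_stepLp (hu hk) (hu k.le_succ) y]
        refine Finset.sum_congr rfl fun k _ => ?_
        split_ifs
        · rfl
        · rw [stepLp_zero]
      · dsimp only
        rw [← sum_ite_eq_of_additive (f := fun i j => S.incr (u i) (u j) y) hab hb
          (S.incr_self (hpos a) hy) fun k hk => S.incr_add (hpos a) (hu hk) (hu k.le_succ) y hy]
        refine Finset.sum_congr rfl fun k _ => ?_
        split_ifs
        · rfl
        · rw [map_zero]
    · have heq : u a = u b := le_antisymm hst (hu hab.le)
      refine ⟨fun _ => 0, fun k => Submodule.zero_mem _, ?_, ?_⟩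
      · simp [← heq, stepLp_self, stepLp_zero]
      · simp [← heq, S.incr_self (hpos a) hy]
  | zero =>
    refine ⟨∅, by simp, fun u n _ _ _ => ⟨fun _ => 0, fun k => Submodule.zero_mem _, ?_, ?_⟩⟩
    · simp [stepLp_zero]
    · simp
  | add p q _ _ hp hq =>
    obtain ⟨F, hF0, hF⟩ := hp
    obtain ⟨G, hG0, hG⟩ := hq
    refine ⟨F ∪ G, fun x hx => (Finset.mem_union.1 hx).elim (hF0 x) (hG0 x),
      fun u n hu h0 h => ?_⟩
    obtain ⟨v, hv, hv1, hv2⟩ := hF u n hu h0 fun x hx => h x (Finset.mem_union_left _ hx)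
    obtain ⟨w, hw, hw1, hw2⟩ := hG u n hu h0 fun x hx => h x (Finset.mem_union_right _ hx)
    refine ⟨fun k => v k + w k, fun k => Submodule.add_mem _ (hv k) (hw k), ?_, ?_⟩
    · simp only [Prod.fst_add, hv1, hw1, stepLp_add, Finset.sum_add_distrib]
    · simp only [Prod.snd_add, hv2, hw2, map_add, Finset.sum_add_distrib]
  | smul c p _ hp =>
    obtain ⟨F, hF0, hF⟩ := hp
    refine ⟨F, hF0, fun u n hu h0 h => ?_⟩
    obtain ⟨v, hv, hv1, hv2⟩ := hF u n hu h0 h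
    refine ⟨fun k => c • v k, fun k => Submodule.smul_mem _ c (hv k), ?_, ?_⟩
    · simp only [Prod.smul_fst, hv1, stepLp_smul, Finset.smul_sum]
    · simp only [Prod.smul_snd, hv2, map_smul, Finset.smul_sum]

theorem norm_sum_incr_sq_le {u : ℕ → ℝ} (hu : Monotone u) (h0 : 0 ≤ u 0) {v : ℕ → H}
    (hv : ∀ k, v k ∈ S.past (u k)) (n : ℕ) :
    (∑ k ∈ Finset.range n, S.incr (u k) (u (k + 1)) (v k)) ∈ S.past (u n) ∧
    ‖∑ k ∈ Finset.range n, S.incr (u k) (u (k + 1)) (v k)‖ ^ 2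
      ≤ S.const * ∑ k ∈ Finset.range n, (u (k + 1) - u k) * ‖v k‖ ^ 2 := by
  induction n with
  | zero => simp
  | succ n ih =>
    have hn : 0 ≤ u n := h0.trans (hu n.zero_le)
    have hn' : u n ≤ u (n + 1) := hu n.le_succ
    rw [Finset.sum_range_succ, Finset.sum_range_succ]
    refine ⟨Submodule.add_mem _ (S.past_mono hn hn' ih.1) (S.incr_mem hn hn' _ (hv n)), ?_⟩
    have h2 := norm_add_sq_eq_norm_sq_add_norm_sq_of_inner_eq_zero _ _
      (S.inner_incr hn hn' _ (hv n) _ ih.1)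
    rw [sq, h2, ← sq, ← sq, mul_add]
    exact add_le_add ih.2 (S.norm_incr_sq_le hn hn' _ (hv n))

/-- The Itô inequality `‖∫ dc y‖² ≤ K ∫ ‖y‖²`. -/
theorem norm_sq_le_of_mem_itoGraph {p : Lp H 2 (volume : Measure ℝ) × H} (hp : p ∈ S.itoGraph) :
    ‖p.2‖ ^ 2 ≤ S.const * ‖p.1‖ ^ 2 := by
  have hclosed : IsClosed {p : Lp H 2 (volume : Measure ℝ) × H |
      ‖p.2‖ ^ 2 ≤ S.const * ‖p.1‖ ^ 2} := isClosed_le (by fun_prop) (by fun_prop)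
  refine closure_minimal (fun p hp => ?_) hclosed hp
  obtain ⟨F, hF0, hF⟩ := exists_nodes_of_mem_simpleGraph hp
  obtain ⟨u, n, hu, h0, hn⟩ := exists_monotone_nodes hF0
  obtain ⟨v, hv, h1, h2⟩ := hF u n hu h0 hn
  rw [Set.mem_ofPred, h1, h2, norm_sum_stepLp_sq hu]
  exact (norm_sum_incr_sq_le hu h0 hv n).2

theorem itoGraph_unique {f : Lp H 2 (volume : Measure ℝ)} {I J : H} (hI : (f, I) ∈ S.itoGraph)
    (hJ : (f, J) ∈ S.itoGraph) : I = J := by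
  have h := norm_sq_le_of_mem_itoGraph (Submodule.sub_mem _ hI hJ)
  rw [Prod.mk_sub_mk, sub_self, norm_zero] at h
  have h' : ‖I - J‖ ^ 2 ≤ 0 := by simpa using h
  exact sub_eq_zero.1 (norm_eq_zero.1 (pow_eq_zero_iff two_ne_zero |>.1
    (le_antisymm h' (sq_nonneg _))))

theorem isClosed_itoGraph : IsClosed (S.itoGraph : Set (Lp H 2 (volume : Measure ℝ) × H)) :=
  Submodule.isClosed_topologicalClosure _

end ItoSystem

/-! ### Approximation of adapted processes by simple ones -/

section Averages

variable {H : Type*} [NormedAddCommGroup H] [InnerProductSpace ℂ H]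

theorem norm_toLp_sq {α : Type*} [MeasurableSpace α] {μ : Measure α} {f : α → H}
    (hf : MemLp f 2 μ) : ‖hf.toLp f‖ ^ 2 = ∫ r, ‖f r‖ ^ 2 ∂μ := by
  have h1 := norm_sq_eq_re_inner (𝕜 := ℂ) (hf.toLp f)
  rw [L2.inner_def] at h1
  rw [h1, ← integral_re (L2.integrable_inner _ _)]
  refine integral_congr_ae (hf.coeFn_toLp.mono fun r hr => ?_)
  simp only [hr]
  exact (norm_sq_eq_re_inner (𝕜 := ℂ) (f r)).symm

/-- The Cauchy-Schwarz inequality `‖∫ f‖² ≤ (b - a) ∫ ‖f‖²` on an interval. -/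
theorem norm_intervalIntegral_sq_le {f : ℝ → H} {a b : ℝ} (hab : a ≤ b)
    (hf : MemLp f 2 (volume.restrict (Set.Ioc a b))) :
    ‖∫ r in a..b, f r‖ ^ 2 ≤ (b - a) * ∫ r in a..b, ‖f r‖ ^ 2 := by
  rw [intervalIntegral.integral_of_le hab, intervalIntegral.integral_of_le hab]
  set μ := (volume : Measure ℝ).restrict (Set.Ioc a b) with hμ
  have hreal : μ.real Set.univ = b - a := by
    simp [hμ, Measure.real, hab]
  have hint : Integrable (fun r => ‖f r‖) μ := (hf.integrable one_le_two).norm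
  have hint2 : Integrable (fun r => ‖f r‖ ^ 2) μ := hf.norm.integrable_sq
  set m := ∫ r, ‖f r‖ ∂μ
  set q := ∫ r, ‖f r‖ ^ 2 ∂μ
  -- Integrate `0 ≤ ((b - a) ‖f‖ - m)²`.
  have h1 : 0 ≤ ∫ r, ((b - a) * ‖f r‖ - m) ^ 2 ∂μ := integral_nonneg fun r => sq_nonneg _
  have h2 : ∫ r, ((b - a) * ‖f r‖ - m) ^ 2 ∂μ
      = (b - a) ^ 2 * q - 2 * (b - a) * m * m + (b - a) * m ^ 2 := by
    have : ∀ r, ((b - a) * ‖f r‖ - m) ^ 2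
        = (b - a) ^ 2 * ‖f r‖ ^ 2 - 2 * (b - a) * m * ‖f r‖ + m ^ 2 := fun r => by ring
    simp only [this]
    rw [integral_add (f := fun r => (b - a) ^ 2 * ‖f r‖ ^ 2 - 2 * (b - a) * m * ‖f r‖)
      ((hint2.const_mul _).sub (hint.const_mul _)) (integrable_const _),
      integral_sub (hint2.const_mul _) (hint.const_mul _), integral_const_mul, integral_const_mul,
      integral_const, hreal, smul_eq_mul]
  rw [h2] at h1
  have h3 : ‖∫ r, f r ∂μ‖ ≤ m := norm_integral_le_integral_norm _
  have h4 : ‖∫ r, f r ∂μ‖ ^ 2 ≤ m ^ 2 := pow_le_pow_left₀ (norm_nonneg _) h3 2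
  refine h4.trans ?_
  rcases hab.eq_or_lt with rfl | hlt
  · have : m = 0 := by simp [m, hμ]
    simp [this]
  · have : 0 < b - a := sub_pos.2 hlt
    nlinarith

/-- The average of `f` over the cell `[(k-1)h, kh]` preceding the node `kh`. -/
noncomputable def cellAvg (h : ℝ) (f : ℝ → H) (k : ℕ) : H :=
  h⁻¹ • ∫ r in ((k : ℝ) - 1) * h..k * h, f r

/-- The process which on every cell `[kh, (k+1)h)` is the average of `f` over the preceding cell. -/
noncomputable def cellStep (h : ℝ) (n : ℕ) (f : ℝ → H) (r : ℝ) : H :=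
  ∑ k ∈ Finset.range n,
    (Set.Ico ((k : ℝ) * h) (((k + 1 : ℕ) : ℝ) * h)).indicator (fun _ => cellAvg h f k) r

theorem cellStep_sub {f g : ℝ → H} (hf : LocallyIntegrable f) (hg : LocallyIntegrable g) (h : ℝ)
    (n : ℕ) (r : ℝ) : cellStep h n (fun r => f r - g r) r = cellStep h n f r - cellStep h n g r := by
  have hi : ∀ {f : ℝ → H}, LocallyIntegrable f → ∀ a b, IntervalIntegrable f volume a b :=
    fun hf a b => ⟨(hf.integrableOn_isCompact isCompact_Icc).mono_set Set.Ioc_subset_Icc_self,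
      (hf.integrableOn_isCompact isCompact_Icc).mono_set Set.Ioc_subset_Icc_self⟩
  simp only [cellStep, ← Finset.sum_sub_distrib]
  refine Finset.sum_congr rfl fun k _ => ?_
  rw [cellAvg, intervalIntegral.integral_sub (hi hf _ _) (hi hg _ _), smul_sub]
  by_cases hr : r ∈ Set.Ico ((k : ℝ) * h) (((k + 1 : ℕ) : ℝ) * h)
  · simp only [Set.indicator_of_mem hr, cellAvg]
  · simp only [Set.indicator_of_notMem hr, sub_zero]

/-- Averaging over the preceding cells is a contraction of `L²(ℝ; H)`. -/
theorem eLpNorm_cellStep_le {f : ℝ → H} (hf : MemLp f 2 volume) {h : ℝ} (hh : 0 < h) (n : ℕ) :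
    eLpNorm (cellStep h n f) 2 volume ≤ eLpNorm f 2 volume := by
  have hu : Monotone fun k : ℕ => (k : ℝ) * h := fun i j hij =>
    mul_le_mul_of_nonneg_right (by exact_mod_cast hij) hh.le
  have hcoe := sum_stepLp_coeFn (fun k : ℕ => (k : ℝ) * h) (cellAvg h f) n
  have hint2 : Integrable (fun r => ‖f r‖ ^ 2) volume := hf.norm.integrable_sq
  have hbound : ‖∑ k ∈ Finset.range n, stepLp ((k : ℝ) * h) (((k + 1 : ℕ) : ℝ) * h)
      (cellAvg h f k)‖ ^ 2 ≤ ∫ r, ‖f r‖ ^ 2 := by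
    rw [norm_sum_stepLp_sq hu]
    have hcell : ∀ k ∈ Finset.range n, (((k + 1 : ℕ) : ℝ) * h - k * h) * ‖cellAvg h f k‖ ^ 2
        ≤ ∫ r in ((k : ℝ) - 1) * h..(((k + 1 : ℕ) : ℝ) - 1) * h, ‖f r‖ ^ 2 := fun k _ => by
      have h1 := norm_intervalIntegral_sq_le (f := f) (a := ((k : ℝ) - 1) * h) (b := k * h)
        (by nlinarith) (hf.restrict _)
      have h2 : (((k + 1 : ℕ) : ℝ) - 1) * h = k * h := by push_cast; ring
      rw [h2, cellAvg, norm_smul, mul_pow, Real.norm_eq_abs, sq_abs]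
      have h3 : ((k + 1 : ℕ) : ℝ) * h - k * h = h := by push_cast; ring
      have h4 : (k : ℝ) * h - (k - 1) * h = h := by ring
      rw [h4] at h1
      rw [h3, ← mul_assoc]
      calc _ ≤ h * h⁻¹ ^ 2 * (h * ∫ r in ((k : ℝ) - 1) * h..k * h, ‖f r‖ ^ 2) := by gcongr
        _ = _ := by field_simp
    refine (Finset.sum_le_sum hcell).trans ?_
    rw [intervalIntegral.sum_integral_adjacent_intervals
      (a := fun k : ℕ => ((k : ℝ) - 1) * h) (fun k _ => hint2.intervalIntegrable),
      intervalIntegral.integral_of_le (by gcongr; exact n.zero_le)]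
    exact setIntegral_le_integral hint2 (.of_forall fun r => by positivity)
  rw [show cellStep h n f = fun r => ∑ k ∈ Finset.range n, (Set.Ico ((k : ℝ) * h)
    (((k + 1 : ℕ) : ℝ) * h)).indicator (fun _ => cellAvg h f k) r from rfl,
    ← eLpNorm_congr_ae hcoe]
  have hLp := norm_toLp_sq hf
  rw [← hLp] at hbound
  have h1 := abs_le_of_sq_le_sq' hbound (norm_nonneg _) |>.2
  rw [← Lp.enorm_def, ← Lp.enorm_toLp hf]
  rw [← ofReal_norm, ← ofReal_norm]
  exact ENNReal.ofReal_le_ofReal h1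

/-- For `r ∈ [0, nh)` the averaged process at `r` is an average of values of `f` at distance at most
`2h` from `r`. -/
theorem norm_cellStep_sub_le [CompleteSpace H] {g : ℝ → H} (hg : Continuous g) {h δ : ℝ} (hh : 0 < h) {n : ℕ}
    {r : ℝ} (hr : r ∈ Set.Ico 0 ((n : ℝ) * h))
    (hδ : ∀ s, |s - r| ≤ 2 * h → ‖g s - g r‖ ≤ δ) : ‖cellStep h n g r - g r‖ ≤ δ := by
  set k := ⌊r / h⌋₊ with hk
  have hk1 : (k : ℝ) * h ≤ r := by
    rw [← le_div_iff₀ hh]; exact Nat.floor_le (div_nonneg hr.1 hh.le)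
  have hk2 : r < ((k + 1 : ℕ) : ℝ) * h := by
    rw [← div_lt_iff₀ hh]; push_cast; exact Nat.lt_floor_add_one _
  have hkn : k < n := by
    have : (k : ℝ) * h < n * h := hk1.trans_lt hr.2
    exact_mod_cast lt_of_mul_lt_mul_right this hh.le
  have hval : cellStep h n g r = cellAvg h g k := by
    rw [cellStep, Finset.sum_eq_single_of_mem k (Finset.mem_range.2 hkn)]
    · exact Set.indicator_of_mem (Set.mem_Ico.2 ⟨hk1, hk2⟩) _
    · intro j _ hj
      refine Set.indicator_of_notMem (fun hmem => hj ?_) _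
      have h1 : (j : ℝ) * h < ((k + 1 : ℕ) : ℝ) * h := hmem.1.trans_lt hk2
      have h2 : (k : ℝ) * h < ((j + 1 : ℕ) : ℝ) * h := hk1.trans_lt hmem.2
      have h3 : j < k + 1 := by exact_mod_cast lt_of_mul_lt_mul_right h1 hh.le
      have h4 : k < j + 1 := by exact_mod_cast lt_of_mul_lt_mul_right h2 hh.le
      omega
  have hlen : (k : ℝ) * h - ((k : ℝ) - 1) * h = h := by ring
  have hdiff : cellAvg h g k - g r = h⁻¹ • ∫ s in ((k : ℝ) - 1) * h..k * h, (g s - g r) := by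
    rw [intervalIntegral.integral_sub (hg.intervalIntegrable _ _) (by simp),
      intervalIntegral.integral_const, hlen, smul_sub, smul_smul, inv_mul_cancel₀ hh.ne', one_smul,
      cellAvg]
  have hI : ‖∫ s in ((k : ℝ) - 1) * h..k * h, (g s - g r)‖ ≤ δ * |(k : ℝ) * h - (k - 1) * h| := by
    refine intervalIntegral.norm_integral_le_of_norm_le_const fun s hs => hδ s ?_
    rw [Set.uIoc_of_le (by nlinarith)] at hs
    push_cast at hk2
    rw [abs_le]
    constructor <;> nlinarith [hs.1, hs.2]
  rw [hlen, abs_of_pos hh] at hI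
  rw [hval, hdiff, norm_smul, Real.norm_eq_abs, abs_of_pos (inv_pos.2 hh)]
  calc _ ≤ h⁻¹ * (δ * h) := by gcongr
    _ = δ := by field_simp

/-- The integral over an interval of a function with values in a closed subspace. -/
theorem intervalIntegral_mem [CompleteSpace H] {K : Submodule ℂ H} (hK : IsClosed (K : Set H))
    {f : ℝ → H} {a b : ℝ} (hab : a ≤ b) (hf : IntegrableOn f (Set.Ioc a b))
    (hmem : ∀ᵐ r ∂volume.restrict (Set.Ioc a b), f r ∈ K) : ∫ r in a..b, f r ∈ K := by
  have : CompleteSpace K := hK.completeSpace_coe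
  rw [intervalIntegral.integral_of_le hab, ← Submodule.starProjection_eq_self_iff,
    ← ContinuousLinearMap.integral_comp_comm _ hf]
  exact integral_congr_ae (hmem.mono fun r hr => Submodule.starProjection_eq_self_iff.2 hr)

theorem tendsto_eLpNorm_cellStep [CompleteSpace H] {t : ℝ} (ht : 0 < t) {f : ℝ → H} (hf : MemLp f 2 volume) :
    Tendsto (fun m : ℕ => eLpNorm (fun r => cellStep (t / (m + 1)) (m + 1) f r - f r) 2
      (volume.restrict (Set.Icc 0 t))) atTop (𝓝 0) := by
  rw [ENNReal.tendsto_atTop_zero]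
  intro ε hε
  have hε3 : ε / 3 ≠ 0 := (ENNReal.div_pos hε.ne' (by simp)).ne'
  obtain ⟨g, hgs, hgf, hgc, hgm⟩ := hf.exists_hasCompactSupport_eLpNorm_sub_le (by simp) hε3
  have hgu : UniformContinuous g := hgs.uniformContinuous_of_continuous hgc
  have hv : (volume.restrict (Set.Icc 0 t)) Set.univ ^ (2 : ℝ≥0∞).toReal⁻¹ ≠ ∞ := by
    simp
  obtain ⟨δ, hδ0, hδ⟩ := ENNReal.exists_nnreal_pos_mul_lt hv hε3
  obtain ⟨η, hη0, hη⟩ := Metric.uniformContinuous_iff.1 hgu δ hδ0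
  obtain ⟨N, hN⟩ := exists_nat_gt (2 * t / η)
  refine ⟨N, fun m hm => ?_⟩
  have hm1 : (0 : ℝ) < m + 1 := by positivity
  set h := t / ((m : ℝ) + 1) with hh
  have hh0 : 0 < h := div_pos ht hm1
  have hnh : ((m + 1 : ℕ) : ℝ) * h = t := by rw [hh]; push_cast; field_simp
  have h2h : 2 * h < η := by
    rw [hh, mul_div_assoc', div_lt_iff₀ hm1]
    rw [div_lt_iff₀ hη0] at hN
    have : (N : ℝ) ≤ m := by exact_mod_cast hm
    nlinarith
  have hloc : ∀ {f : ℝ → H}, MemLp f 2 volume → LocallyIntegrable f volume := fun hf =>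
    hf.locallyIntegrable one_le_two
  have hstep_meas : ∀ f : ℝ → H, AEStronglyMeasurable (cellStep h (m + 1) f) volume := fun f => by
    refine Finset.aestronglyMeasurable_fun_sum _ fun k _ => ?_
    exact (stronglyMeasurable_const.indicator measurableSet_Ico).aestronglyMeasurable
  set μ := (volume : Measure ℝ).restrict (Set.Icc 0 t)
  have hle : μ ≤ volume := Measure.restrict_le_self
  have hsplit : (fun r => cellStep h (m + 1) f r - f r)
      = (cellStep h (m + 1) fun r => f r - g r)
        + ((fun r => cellStep h (m + 1) g r - g r) - (f - g)) := by
    ext r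
    simp only [Pi.add_apply, Pi.sub_apply, cellStep_sub (hloc hf) (hloc hgm)]
    abel
  have hfg : MemLp (f - g) 2 volume := hf.sub hgm
  have e1 : eLpNorm (cellStep h (m + 1) fun r => f r - g r) 2 μ ≤ ε / 3 :=
    (eLpNorm_mono_measure _ hle).trans ((eLpNorm_cellStep_le hfg hh0 _).trans hgf)
  have e3 : eLpNorm (f - g) 2 μ ≤ ε / 3 := (eLpNorm_mono_measure _ hle).trans hgf
  have e2 : eLpNorm (fun r => cellStep h (m + 1) g r - g r) 2 μ ≤ ε / 3 := by
    have hae : ∀ᵐ r ∂μ, ‖cellStep h (m + 1) g r - g r‖ ≤ δ := by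
      have hne : ∀ᵐ r ∂μ, r ≠ t := ae_restrict_of_ae (Measure.ae_ne volume t)
      filter_upwards [hne, ae_restrict_mem measurableSet_Icc] with r hr hr'
      refine norm_cellStep_sub_le hgc hh0 ⟨hr'.1, ?_⟩ fun s hs => ?_
      · rw [hnh]; exact lt_of_le_of_ne hr'.2 hr
      · have := hη (a := s) (b := r) (by rw [Real.dist_eq]; linarith)
        rw [dist_eq_norm] at this
        exact this.le
    refine (eLpNorm_le_of_ae_bound hae).trans ?_
    rw [ENNReal.ofReal_coe_nnreal, mul_comm]
    exact hδ.le
  rw [hsplit]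
  have m1 := ((hstep_meas fun r => f r - g r).mono_measure hle)
  have m2 : AEStronglyMeasurable (fun r => cellStep h (m + 1) g r - g r) μ :=
    ((hstep_meas g).sub hgm.1).mono_measure hle
  have m3 : AEStronglyMeasurable (f - g) μ := hfg.1.mono_measure hle
  calc _ ≤ eLpNorm (cellStep h (m + 1) fun r => f r - g r) 2 μ
        + (eLpNorm (fun r => cellStep h (m + 1) g r - g r) 2 μ + eLpNorm (f - g) 2 μ) :=
        (eLpNorm_add_le m1 (m2.sub m3) one_le_two).trans
          (add_le_add le_rfl (eLpNorm_sub_le m2 m3 one_le_two))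
    _ ≤ ε / 3 + (ε / 3 + ε / 3) := add_le_add e1 (add_le_add e2 e3)
    _ = ε := by rw [← add_assoc, ENNReal.add_thirds]

/-- Adapted square integrable processes on `[0, t]` are limits of simple adapted processes on
equidistant partitions. -/
theorem ItoSystem.exists_simple_approx [CompleteSpace H] (S : ItoSystem H) {t : ℝ} (ht : 0 < t)
    {f : ℝ → H} (hf : MemLp f 2 (volume.restrict (Set.Icc 0 t)))
    (had : ∀ᵐ r ∂volume.restrict (Set.Icc 0 t), f r ∈ S.past r) :
    ∃ v : ℕ → ℕ → H, (∀ m k : ℕ, v m k ∈ S.past (k * (t / (m + 1)))) ∧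
      Tendsto (fun m : ℕ => eLpNorm (fun r => ∑ k ∈ Finset.range (m + 1),
        (Set.Ico ((k : ℝ) * (t / (m + 1))) (((k + 1 : ℕ) : ℝ) * (t / (m + 1)))).indicator
          (fun _ => v m k) r - f r) 2 (volume.restrict (Set.Icc 0 t))) atTop (𝓝 0) := by
  set f' := (Set.Icc 0 t).indicator f with hf'
  have hf'm : MemLp f' 2 volume := (memLp_indicator_iff_restrict measurableSet_Icc).2 hf
  rw [ae_restrict_iff' measurableSet_Icc] at had
  refine ⟨fun m k => cellAvg (t / (m + 1)) f' k, fun m k => ?_, ?_⟩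
  · have hh : 0 < t / ((m : ℝ) + 1) := by positivity
    have hab : ((k : ℝ) - 1) * (t / (m + 1)) ≤ k * (t / (m + 1)) := by nlinarith
    have hint : IntegrableOn f' (Set.Ioc (((k : ℝ) - 1) * (t / (m + 1))) (k * (t / (m + 1)))) :=
      (hf'm.restrict _).integrable one_le_two
    dsimp only
    rw [cellAvg, ← Complex.coe_smul]
    refine Submodule.smul_mem _ _ (intervalIntegral_mem (S.isClosed_past _) hab hint ?_)
    filter_upwards [ae_restrict_of_ae had, ae_restrict_mem measurableSet_Ioc] with r hr hr'
    by_cases hmem : r ∈ Set.Icc 0 t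
    · rw [hf', Set.indicator_of_mem hmem]
      exact S.past_mono hmem.1 hr'.2 (hr hmem)
    · rw [hf', Set.indicator_of_notMem hmem]
      exact Submodule.zero_mem _
  · refine (tendsto_eLpNorm_cellStep ht hf'm).congr fun m => eLpNorm_congr_ae ?_
    filter_upwards [ae_restrict_mem measurableSet_Icc] with r hr
    rw [hf', Set.indicator_of_mem hr]
    rfl

end Averages

namespace ItoSystem

variable {H : Type*} [NormedAddCommGroup H] [InnerProductSpace ℂ H] {S : ItoSystem H}

/-! ### The Itô integral over `[0, t]` -/

variable (S) in
/-- `J = ∫_0^t dc_s y_s`: the pair of `y χ_{[0, t]}` and `J` belongs to the graph of the Itô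
integral. -/
def IsIto (t : ℝ) (y : ℝ → H) (J : H) : Prop :=
  ∃ hy : MemLp ((Set.Icc 0 t).indicator y) 2 volume, (hy.toLp _, J) ∈ S.itoGraph

theorem IsIto.unique {t : ℝ} {y : ℝ → H} {I J : H} (hI : S.IsIto t y I) (hJ : S.IsIto t y J) :
    I = J := by
  obtain ⟨_, hI⟩ := hI
  obtain ⟨_, hJ⟩ := hJ
  exact itoGraph_unique hI hJ

theorem IsIto.sub {t : ℝ} {y z : ℝ → H} {I J : H} (hI : S.IsIto t y I) (hJ : S.IsIto t z J) :
    S.IsIto t (fun r => y r - z r) (I - J) := by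
  obtain ⟨hy, hI⟩ := hI
  obtain ⟨hz, hJ⟩ := hJ
  have h : (Set.Icc 0 t).indicator (fun r => y r - z r)
      = (Set.Icc 0 t).indicator y - (Set.Icc 0 t).indicator z := Set.indicator_sub _ _ _
  refine ⟨h ▸ hy.sub hz, ?_⟩
  have := Submodule.sub_mem _ hI hJ
  rw [Prod.mk_sub_mk, ← MemLp.toLp_sub hy hz] at this
  simpa only [h] using this

theorem IsIto.norm_sq_le {t : ℝ} {y : ℝ → H} {J : H} (hJ : S.IsIto t y J) :
    ‖J‖ ^ 2 ≤ S.const * ∫ r in Set.Icc 0 t, ‖y r‖ ^ 2 := by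
  obtain ⟨hy, hJ⟩ := hJ
  have h := norm_sq_le_of_mem_itoGraph hJ
  rw [norm_toLp_sq] at h
  convert h using 2
  rw [← integral_indicator measurableSet_Icc]
  refine integral_congr_ae (.of_forall fun r => ?_)
  by_cases hr : r ∈ Set.Icc 0 t <;> simp [Set.indicator, hr]

theorem IsIto.norm_sub_sq_le {s t : ℝ} (hst : s ≤ t) {y : ℝ → H} {I J : H}
    (hI : S.IsIto s y I) (hJ : S.IsIto t y J) :
    ‖J - I‖ ^ 2 ≤ S.const * ∫ r in Set.Icc 0 t \ Set.Icc 0 s, ‖y r‖ ^ 2 := by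
  obtain ⟨hs, hI⟩ := hI
  obtain ⟨ht, hJ⟩ := hJ
  have h := norm_sq_le_of_mem_itoGraph (Submodule.sub_mem _ hJ hI)
  rw [Prod.mk_sub_mk, ← MemLp.toLp_sub ht hs, norm_toLp_sq] at h
  convert h using 2
  rw [← integral_indicator (measurableSet_Icc.diff measurableSet_Icc)]
  refine integral_congr_ae (.of_forall fun r => ?_)
  have hsub : Set.Icc 0 s ⊆ Set.Icc 0 t := Set.Icc_subset_Icc_right hst
  by_cases h1 : r ∈ Set.Icc 0 s
  · have h2 := hsub h1
    simp only [Pi.sub_apply, Set.indicator_of_mem h1, Set.indicator_of_mem h2, sub_self, norm_zero]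
    rw [Set.indicator_of_notMem fun h' => h'.2 h1]
    simp
  · by_cases h2 : r ∈ Set.Icc 0 t
    · simp only [Pi.sub_apply, Set.indicator_of_notMem h1, Set.indicator_of_mem h2, sub_zero]
      rw [Set.indicator_of_mem (Set.mem_sdiff _ |>.2 ⟨h2, h1⟩)]
    · simp only [Pi.sub_apply, Set.indicator_of_notMem h1, Set.indicator_of_notMem h2, sub_zero,
        norm_zero]
      rw [Set.indicator_of_notMem fun h' => h2 h'.1]
      simp

/-- The Itô integral of a limit of simple processes. -/
theorem isIto_of_tendsto {t : ℝ} {y : ℝ → H} (hy : MemLp y 2 (volume.restrict (Set.Icc 0 t)))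
    {u : ℕ → ℕ → ℝ} {n : ℕ → ℕ} {v : ℕ → ℕ → H} {J : H}
    (hu : ∀ m, ∀ k < n m, 0 ≤ u m k ∧ u m k ≤ u m (k + 1) ∧ u m (k + 1) ≤ t)
    (hv : ∀ m, ∀ k < n m, v m k ∈ S.past (u m k))
    (hlim : Tendsto (fun m => eLpNorm (fun r => ∑ k ∈ Finset.range (n m),
      (Set.Ico (u m k) (u m (k + 1))).indicator (fun _ => v m k) r - y r) 2
        (volume.restrict (Set.Icc 0 t))) atTop (𝓝 0))
    (hJ : Tendsto (fun m => ∑ k ∈ Finset.range (n m), S.incr (u m k) (u m (k + 1)) (v m k))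
      atTop (𝓝 J)) : S.IsIto t y J := by
  have hy' : MemLp ((Set.Icc 0 t).indicator y) 2 volume :=
    (memLp_indicator_iff_restrict measurableSet_Icc).2 hy
  refine ⟨hy', ?_⟩
  have h : Tendsto (fun m => ∑ k ∈ Finset.range (n m), stepLp (u m k) (u m (k + 1)) (v m k)) atTop
      (𝓝 (hy'.toLp _)) := by
    rw [Lp.tendsto_Lp_iff_tendsto_eLpNorm _ _ hy']
    refine hlim.congr fun m => ?_
    exact (eLpNorm_sum_stepLp_sub (fun k hk => ⟨(hu m k hk).1, (hu m k hk).2.2⟩) y).symm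
  exact isClosed_itoGraph.mem_of_tendsto (h.prodMk_nhds hJ) (.of_forall fun m =>
    sum_mem_itoGraph (fun k hk => (hu m k hk).2.1) (fun k hk => (hu m k hk).1) (hv m))

/-- Itô integrals converge along with the integrands. -/
theorem exists_tendsto_of_itoGraph [CompleteSpace H] {f : ℕ → Lp H 2 (volume : Measure ℝ)}
    {g : Lp H 2 (volume : Measure ℝ)} {J : ℕ → H} (hf : Tendsto f atTop (𝓝 g))
    (hJ : ∀ m, (f m, J m) ∈ S.itoGraph) : ∃ I, Tendsto J atTop (𝓝 I) := by
  refine cauchySeq_tendsto_of_complete (Metric.cauchySeq_iff.2 fun ε hε => ?_)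
  obtain ⟨N, hN⟩ := Metric.cauchySeq_iff.1 hf.cauchySeq (ε / (√S.const + 1)) (by positivity)
  refine ⟨N, fun m hm n hn => ?_⟩
  have h1 := norm_sq_le_of_mem_itoGraph (Submodule.sub_mem _ (hJ m) (hJ n))
  rw [Prod.mk_sub_mk] at h1
  have h2 : ‖J m - J n‖ ≤ √S.const * ‖f m - f n‖ := by
    refine abs_le_of_sq_le_sq' ?_ (by positivity) |>.2
    rw [mul_pow, Real.sq_sqrt S.const_nonneg]; exact h1
  have h3 := hN m hm n hn
  rw [dist_eq_norm, lt_div_iff₀ (by positivity)] at h3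
  rw [dist_eq_norm]
  nlinarith [norm_nonneg (f m - f n)]

/-- The Itô integral of an adapted process exists, as the limit of the integrals of simple processes
on equidistant partitions. -/
theorem exists_ito_approx [CompleteSpace H] {t : ℝ} (ht : 0 < t) {y : ℝ → H}
    (hy : MemLp y 2 (volume.restrict (Set.Icc 0 t)))
    (had : ∀ᵐ r ∂volume.restrict (Set.Icc 0 t), y r ∈ S.past r) :
    ∃ (v : ℕ → ℕ → H) (J : H), (∀ m k : ℕ, v m k ∈ S.past (k * (t / (m + 1)))) ∧
      Tendsto (fun m : ℕ => eLpNorm (fun r => ∑ k ∈ Finset.range (m + 1),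
        (Set.Ico ((k : ℝ) * (t / (m + 1))) (((k + 1 : ℕ) : ℝ) * (t / (m + 1)))).indicator
          (fun _ => v m k) r - y r) 2 (volume.restrict (Set.Icc 0 t))) atTop (𝓝 0) ∧
      Tendsto (fun m : ℕ => ∑ k ∈ Finset.range (m + 1),
        S.incr (k * (t / (m + 1))) ((k + 1 : ℕ) * (t / (m + 1))) (v m k)) atTop (𝓝 J) ∧
      J ∈ S.past t ∧ S.IsIto t y J := by
  obtain ⟨v, hv, hlim⟩ := S.exists_simple_approx ht hy had
  have hh : ∀ m : ℕ, 0 < t / ((m : ℝ) + 1) := fun m => by positivity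
  have hmono : ∀ m : ℕ, Monotone fun k : ℕ => (k : ℝ) * (t / ((m : ℝ) + 1)) := fun m i j hij =>
    mul_le_mul_of_nonneg_right (by exact_mod_cast hij) (hh m).le
  have hlast : ∀ m : ℕ, ((m + 1 : ℕ) : ℝ) * (t / ((m : ℝ) + 1)) = t := fun m => by
    push_cast; field_simp
  have hu : ∀ m : ℕ, ∀ k < m + 1, 0 ≤ (k : ℝ) * (t / ((m : ℝ) + 1)) ∧
      (k : ℝ) * (t / ((m : ℝ) + 1)) ≤ ((k + 1 : ℕ) : ℝ) * (t / ((m : ℝ) + 1)) ∧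
      ((k + 1 : ℕ) : ℝ) * (t / ((m : ℝ) + 1)) ≤ t := fun m k hk => by
    refine ⟨mul_nonneg k.cast_nonneg (hh m).le, hmono m k.le_succ, ?_⟩
    conv_rhs => rw [← hlast m]
    exact hmono m (Nat.succ_le_of_lt hk)
  have hy' : MemLp ((Set.Icc 0 t).indicator y) 2 volume :=
    (memLp_indicator_iff_restrict measurableSet_Icc).2 hy
  have hconv : Tendsto (fun m : ℕ => ∑ k ∈ Finset.range (m + 1), stepLp ((k : ℝ) * (t / (m + 1)))
      (((k + 1 : ℕ) : ℝ) * (t / (m + 1))) (v m k)) atTop (𝓝 (hy'.toLp _)) := by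
    rw [Lp.tendsto_Lp_iff_tendsto_eLpNorm _ _ hy']
    exact hlim.congr fun m => (eLpNorm_sum_stepLp_sub (u := fun k : ℕ => (k : ℝ) * (t / (m + 1)))
      (fun k hk => ⟨(hu m k hk).1, (hu m k hk).2.2⟩) y).symm
  obtain ⟨J, hJ⟩ := exists_tendsto_of_itoGraph (S := S) hconv fun m =>
    sum_mem_itoGraph (u := fun k : ℕ => (k : ℝ) * (t / (m + 1))) (fun k hk => (hu m k hk).2.1)
      (fun k hk => (hu m k hk).1) fun k _ => hv m k
  refine ⟨v, J, hv, hlim, hJ, ?_, isIto_of_tendsto hy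
    (u := fun m k => (k : ℝ) * (t / ((m : ℝ) + 1))) (n := fun m => m + 1) hu
    (fun m k _ => hv m k) hlim hJ⟩
  refine (S.isClosed_past t).mem_of_tendsto hJ (.of_forall fun m => ?_)
  have := (norm_sum_incr_sq_le (S := S) (hmono m) (by simp) (hv m) (m + 1)).1
  simpa only [hlast, SetLike.mem_coe] using this

theorem exists_isIto [CompleteSpace H] {t : ℝ} (ht : 0 ≤ t) {y : ℝ → H}
    (hy : MemLp y 2 (volume.restrict (Set.Icc 0 t)))
    (had : ∀ᵐ r ∂volume.restrict (Set.Icc 0 t), y r ∈ S.past r) :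
    ∃ J ∈ S.past t, S.IsIto t y J := by
  rcases ht.eq_or_lt with rfl | ht
  · exact ⟨0, Submodule.zero_mem _, isIto_of_tendsto hy (u := fun _ _ => 0) (n := fun _ => 0)
      (v := fun _ _ => 0) (by simp) (by simp) (by simp) (by simp)⟩
  · obtain ⟨_, J, _, _, _, hJ, hJ'⟩ := exists_ito_approx ht hy had
    exact ⟨J, hJ, hJ'⟩

end ItoSystem

namespace ItoSystem

variable {H : Type*} [NormedAddCommGroup H] [InnerProductSpace ℂ H] {S : ItoSystem H}

/-! ### Linear stochastic differential equations in a Hilbert space -/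

variable (S) in
/-- The adapted elements of `L²([0, T]; H)`. -/
def adaptedSet (T : ℝ) : Set (Lp H 2 (volume.restrict (Set.Icc (0 : ℝ) T))) :=
  {y | ∀ᵐ s ∂volume.restrict (Set.Icc (0 : ℝ) T), y s ∈ S.past s}

theorem isClosed_adaptedSet (T : ℝ) : IsClosed (S.adaptedSet T) := by
  refine isClosed_of_closure_subset fun y hy => ?_
  obtain ⟨u, hu, hlim⟩ := mem_closure_iff_seq_limit.1 hy
  obtain ⟨φ, -, hφ⟩ := (tendstoInMeasure_of_tendsto_Lp hlim).exists_seq_tendsto_ae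
  have hu' : ∀ᵐ s ∂volume.restrict (Set.Icc (0 : ℝ) T), ∀ n, u n s ∈ S.past s :=
    ae_all_iff.2 fun n => hu n
  exact Set.mem_ofPred.2 (by
    filter_upwards [hφ, hu'] with s hs hs'
    exact (S.isClosed_past s).mem_of_tendsto hs (.of_forall fun n => hs' _))

theorem restrict_Icc_le {t T : ℝ} (h : t ≤ T) :
    (volume : Measure ℝ).restrict (Set.Icc 0 t) ≤ volume.restrict (Set.Icc 0 T) :=
  Measure.restrict_mono_set _ (Set.Icc_subset_Icc_right h)

theorem norm_Lp_sub_sq {T : ℝ} (y y' : Lp H 2 (volume.restrict (Set.Icc (0 : ℝ) T))) :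
    ‖y - y'‖ ^ 2 = ∫ r in Set.Icc 0 T, ‖y r - y' r‖ ^ 2 := by
  rw [← Lp.toLp_coeFn (y - y') (Lp.memLp _), norm_toLp_sq]
  refine integral_congr_ae ((Lp.coeFn_sub y y').mono fun r hr => ?_)
  simp only [hr, Pi.sub_apply]

variable [CompleteSpace H]

/-- The right hand side `η + ∫_0^t dc y + ∫_0^t D y ds` of the equation, as a continuous adapted
process. -/
theorem exists_rhs (D : H →L[ℂ] H) (hD : ∀ t, 0 ≤ t → ∀ y ∈ S.past t, D y ∈ S.past t) {η : H}
    (hη : η ∈ S.past 0) {T : ℝ} {y : ℝ → H} (hy : MemLp y 2 (volume.restrict (Set.Icc 0 T)))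
    (had : ∀ᵐ r ∂volume.restrict (Set.Icc 0 T), y r ∈ S.past r) :
    ∃ z ∈ S.adaptedSet T, ∀ᵐ t ∂volume.restrict (Set.Icc 0 T),
      S.IsIto t y (z t - η - ∫ r in Set.Icc 0 t, D (y r)) := by
  have hex : ∀ t, ∃ J, t ∈ Set.Icc 0 T → J ∈ S.past t ∧ S.IsIto t y J := fun t => by
    by_cases ht : t ∈ Set.Icc 0 T
    · obtain ⟨J, hJ, hJ'⟩ := exists_isIto (S := S) ht.1 (hy.mono_measure (restrict_Icc_le ht.2))
        (ae_mono (restrict_Icc_le ht.2) had)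
      exact ⟨J, fun _ => ⟨hJ, hJ'⟩⟩
    · exact ⟨0, fun h => absurd h ht⟩
  choose J hJ using hex
  have hint2 : IntegrableOn (fun r => ‖y r‖ ^ 2) (Set.Icc 0 T) := hy.norm.integrable_sq
  have hintD : IntegrableOn (fun r => D (y r)) (Set.Icc 0 T) :=
    D.integrable_comp (hy.integrable one_le_two)
  have hJc : ContinuousOn J (Set.Icc 0 T) := by
    have hprim : ContinuousOn (fun t => ∫ r in Set.Icc 0 t, ‖y r‖ ^ 2) (Set.Icc 0 T) := by
      simpa only [integral_Icc_eq_integral_Ioc] using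
        intervalIntegral.continuousOn_primitive hint2
    have hkey : ∀ s ∈ Set.Icc 0 T, ∀ t ∈ Set.Icc 0 T, s ≤ t → ‖J t - J s‖ ^ 2 ≤ S.const *
        |(∫ r in Set.Icc 0 t, ‖y r‖ ^ 2) - ∫ r in Set.Icc 0 s, ‖y r‖ ^ 2| :=
      fun s hs t ht hst => by
        refine ((hJ s hs).2.norm_sub_sq_le hst (hJ t ht).2).trans
          (mul_le_mul_of_nonneg_left (le_trans (le_of_eq ?_) (le_abs_self _)) S.const_nonneg)
        exact setIntegral_sdiff measurableSet_Icc
          (hint2.mono_set (Set.Icc_subset_Icc_right ht.2)) (Set.Icc_subset_Icc_right hst)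
    intro s hs
    rw [ContinuousWithinAt, tendsto_iff_norm_sub_tendsto_zero]
    have h1 : Tendsto (fun t => √(S.const *
        |(∫ r in Set.Icc 0 t, ‖y r‖ ^ 2) - ∫ r in Set.Icc 0 s, ‖y r‖ ^ 2|))
        (𝓝[Set.Icc 0 T] s) (𝓝 0) := by
      have h2 := (((hprim s hs).sub_const (∫ r in Set.Icc 0 s, ‖y r‖ ^ 2)).abs.const_mul
        S.const).sqrt
      simpa using h2
    refine squeeze_zero' (.of_forall fun t => norm_nonneg _) ?_ h1
    filter_upwards [self_mem_nhdsWithin] with t ht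
    refine Real.le_sqrt_of_sq_le ?_
    rcases le_total s t with hst | hst
    · exact hkey s hs t ht hst
    · rw [norm_sub_rev, abs_sub_comm]; exact hkey t ht s hs hst
  set Z : ℝ → H := fun t => η + J t + ∫ r in Set.Icc 0 t, D (y r) with hZ
  have hZc : ContinuousOn Z (Set.Icc 0 T) := by
    refine (continuousOn_const.add hJc).add ?_
    simpa only [integral_Icc_eq_integral_Ioc] using
      intervalIntegral.continuousOn_primitive hintD
  have hZm : MemLp Z 2 (volume.restrict (Set.Icc 0 T)) := by
    obtain ⟨B, hB⟩ := isCompact_Icc.exists_bound_of_continuousOn hZc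
    exact MemLp.of_bound (hZc.aestronglyMeasurable measurableSet_Icc) B
      (ae_restrict_of_forall_mem measurableSet_Icc hB)
  refine ⟨hZm.toLp Z, Set.mem_ofPred.2 ?_, ?_⟩
  · filter_upwards [hZm.coeFn_toLp, ae_restrict_mem measurableSet_Icc] with t ht htT
    rw [ht, hZ]
    refine Submodule.add_mem _ (Submodule.add_mem _ (S.past_mono le_rfl htT.1 hη) (hJ t htT).1) ?_
    rw [integral_Icc_eq_integral_Ioc, ← intervalIntegral.integral_of_le htT.1]
    have hsub : Set.Ioc 0 t ⊆ Set.Icc 0 T := fun r hr => ⟨hr.1.le, hr.2.trans htT.2⟩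
    refine intervalIntegral_mem (S.isClosed_past t) htT.1 (hintD.mono_set hsub) ?_
    filter_upwards [ae_mono (Measure.restrict_mono_set _ hsub) had,
      ae_restrict_mem measurableSet_Ioc] with r hr hr'
    exact S.past_mono hr'.1.le hr'.2 (hD r hr'.1.le _ hr)
  · filter_upwards [hZm.coeFn_toLp, ae_restrict_mem measurableSet_Icc] with t ht htT
    rw [ht, hZ]
    have : η + J t + (∫ r in Set.Icc 0 t, D (y r)) - η - (∫ r in Set.Icc 0 t, D (y r)) = J t := by
      abel
    simpa only [this] using (hJ t htT).2

/-- The right hand side depends on the process through its past in a Lipschitz way. -/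
theorem norm_rhs_sub_sq_le (D : H →L[ℂ] H) {η : H} {T t : ℝ} (ht : t ∈ Set.Icc 0 T)
    {y y' : ℝ → H} (hy : MemLp y 2 (volume.restrict (Set.Icc 0 T)))
    (hy' : MemLp y' 2 (volume.restrict (Set.Icc 0 T))) {z z' : H}
    (hz : S.IsIto t y (z - η - ∫ r in Set.Icc 0 t, D (y r)))
    (hz' : S.IsIto t y' (z' - η - ∫ r in Set.Icc 0 t, D (y' r))) :
    ‖z - z'‖ ^ 2 ≤ 2 * (S.const + T * ‖D‖ ^ 2) * ∫ r in Set.Icc 0 t, ‖y r - y' r‖ ^ 2 := by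
  have hle := restrict_Icc_le ht.2
  have hyt := hy.mono_measure hle
  have hyt' := hy'.mono_measure hle
  set q := ∫ r in Set.Icc 0 t, ‖y r - y' r‖ ^ 2 with hq
  have hq0 : 0 ≤ q := integral_nonneg fun r => sq_nonneg _
  set w := ∫ r in Set.Icc 0 t, D (y r - y' r) with hw
  have hw' : w = (∫ r in Set.Icc 0 t, D (y r)) - ∫ r in Set.Icc 0 t, D (y' r) := by
    rw [hw, ← integral_sub (D.integrable_comp (hyt.integrable one_le_two))
      (D.integrable_comp (hyt'.integrable one_le_two))]
    simp only [map_sub]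
  have h1 := (hz.sub hz').norm_sq_le
  have h2 : z - η - (∫ r in Set.Icc 0 t, D (y r)) - (z' - η - ∫ r in Set.Icc 0 t, D (y' r))
      = z - z' - w := by rw [hw']; abel
  rw [h2] at h1
  have h3 : ‖w‖ ^ 2 ≤ T * ‖D‖ ^ 2 * q := by
    have hm : MemLp (fun r => y r - y' r) 2 (volume.restrict (Set.Ioc 0 t)) :=
      (hyt.sub hyt').mono_measure (Measure.restrict_mono_set _ Set.Ioc_subset_Icc_self)
    have h4 := norm_intervalIntegral_sq_le ht.1 hm
    have h5 : w = D (∫ r in (0 : ℝ)..t, (y r - y' r)) := by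
      rw [hw, ContinuousLinearMap.integral_comp_comm, intervalIntegral.integral_of_le ht.1,
        integral_Icc_eq_integral_Ioc]
      exact (hyt.sub hyt').integrable one_le_two
    rw [intervalIntegral.integral_of_le ht.1 (f := fun r => ‖y r - y' r‖ ^ 2),
      ← integral_Icc_eq_integral_Ioc, ← hq, sub_zero] at h4
    have h6 : ‖w‖ ^ 2 ≤ (‖D‖ * ‖∫ r in (0 : ℝ)..t, (y r - y' r)‖) ^ 2 := by
      rw [h5]; exact pow_le_pow_left₀ (norm_nonneg _) (D.le_opNorm _) 2
    calc _ ≤ ‖D‖ ^ 2 * ‖∫ r in (0 : ℝ)..t, (y r - y' r)‖ ^ 2 := by rw [← mul_pow]; exact h6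
      _ ≤ ‖D‖ ^ 2 * (T * q) := by
        gcongr
        exact h4.trans (mul_le_mul_of_nonneg_right ht.2 hq0)
      _ = _ := by ring
  have h7 : ‖z - z'‖ ≤ ‖z - z' - w‖ + ‖w‖ := by
    simpa using norm_add_le (z - z' - w) w
  have h8 : ‖z - z'‖ ^ 2 ≤ (‖z - z' - w‖ + ‖w‖) ^ 2 := pow_le_pow_left₀ (norm_nonneg _) h7 2
  nlinarith [sq_nonneg (‖z - z' - w‖ - ‖w‖)]

/-- A map on adapted processes whose value at `t` depends on the process up to time `t`, with
Lipschitz dependence in square mean, has exactly one fixed point: its iterates satisfy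
`‖Γⁿ⁺¹ y - Γⁿ⁺¹ y'‖² ≤ T K (K T)ⁿ / n! ‖y - y'‖²`, so some iterate is a contraction. -/
theorem existsUnique_fixedPoint {T : ℝ} (hT : 0 ≤ T) {K : ℝ} (hK : 0 ≤ K)
    (Γ : S.adaptedSet T → S.adaptedSet T)
    (hΓ : ∀ y y' : S.adaptedSet T, ∀ᵐ t ∂volume.restrict (Set.Icc (0 : ℝ) T),
      ‖(Γ y).1 t - (Γ y').1 t‖ ^ 2 ≤ K * ∫ r in Set.Icc 0 t, ‖y.1 r - y'.1 r‖ ^ 2) :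
    ∃! y, Γ y = y := by
  have : CompleteSpace (S.adaptedSet T) := (isClosed_adaptedSet T).completeSpace_coe
  have hne : Nonempty (S.adaptedSet T) :=
    ⟨⟨0, Set.mem_ofPred.2 ((Lp.coeFn_zero H 2 _).mono fun s hs => by
      rw [hs]; exact Submodule.zero_mem _)⟩⟩
  have hint : ∀ y y' : S.adaptedSet T,
      IntegrableOn (fun r => ‖y.1 r - y'.1 r‖ ^ 2) (Set.Icc 0 T) := fun y y' =>
    ((Lp.memLp y.1).sub (Lp.memLp y'.1)).norm.integrable_sq
  have hiter : ∀ (n : ℕ) (y y' : S.adaptedSet T), ∀ᵐ t ∂volume.restrict (Set.Icc (0 : ℝ) T),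
      ‖(Γ^[n + 1] y).1 t - (Γ^[n + 1] y').1 t‖ ^ 2
        ≤ K ^ (n + 1) * ‖y.1 - y'.1‖ ^ 2 / n.factorial * t ^ n := fun n y y' => by
    induction n with
    | zero =>
      filter_upwards [hΓ y y', ae_restrict_mem measurableSet_Icc] with t ht htT
      refine ht.trans ?_
      rw [norm_Lp_sub_sq]
      simp only [zero_add, pow_one, Nat.factorial_zero, Nat.cast_one, div_one, pow_zero, mul_one]
      exact mul_le_mul_of_nonneg_left (setIntegral_mono_set (hint y y')
        (.of_forall fun r => sq_nonneg _) (Set.Icc_subset_Icc_right htT.2).eventuallyLE) hK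
    | succ n ih =>
      filter_upwards [hΓ (Γ^[n + 1] y) (Γ^[n + 1] y'), ae_restrict_mem measurableSet_Icc]
        with t ht htT
      rw [Function.iterate_succ_apply', Function.iterate_succ_apply' Γ (n + 1) y']
      refine ht.trans ?_
      set a := K ^ (n + 1) * ‖y.1 - y'.1‖ ^ 2 / n.factorial with ha
      have h1 : ∫ r in Set.Icc 0 t, ‖(Γ^[n + 1] y).1 r - (Γ^[n + 1] y').1 r‖ ^ 2
          ≤ ∫ r in Set.Icc 0 t, a * r ^ n :=
        integral_mono_ae ((hint _ _).mono_set (Set.Icc_subset_Icc_right htT.2))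
          (Continuous.integrableOn_Icc (by fun_prop)) (ae_mono (restrict_Icc_le htT.2) ih)
      have h2 : ∫ r in Set.Icc 0 t, a * r ^ n = a * (t ^ (n + 1) / (n + 1)) := by
        rw [integral_Icc_eq_integral_Ioc, ← intervalIntegral.integral_of_le htT.1,
          intervalIntegral.integral_const_mul, integral_pow]
        simp
      rw [h2] at h1
      refine (mul_le_mul_of_nonneg_left h1 hK).trans (le_of_eq ?_)
      have hn : (n.factorial : ℝ) ≠ 0 := by exact_mod_cast n.factorial_ne_zero
      rw [ha, Nat.factorial_succ]
      push_cast
      field_simp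
      ring
  have hnorm : ∀ (n : ℕ) (y y' : S.adaptedSet T),
      ‖(Γ^[n + 1] y).1 - (Γ^[n + 1] y').1‖ ^ 2
        ≤ T * K * ((K * T) ^ n / n.factorial) * ‖y.1 - y'.1‖ ^ 2 := fun n y y' => by
    have hb : ∀ᵐ t ∂volume.restrict (Set.Icc (0 : ℝ) T),
        ‖(Γ^[n + 1] y).1 t - (Γ^[n + 1] y').1 t‖ ^ 2
          ≤ K ^ (n + 1) * ‖y.1 - y'.1‖ ^ 2 / n.factorial * T ^ n := by
      filter_upwards [hiter n y y', ae_restrict_mem measurableSet_Icc] with t ht htT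
      refine ht.trans (mul_le_mul_of_nonneg_left (pow_le_pow_left₀ htT.1 htT.2 n) ?_)
      positivity
    rw [norm_Lp_sub_sq]
    refine (integral_mono_ae (hint _ _) (integrable_const _) hb).trans (le_of_eq ?_)
    rw [integral_const, smul_eq_mul, measureReal_restrict_apply_univ, Real.volume_real_Icc_of_le hT]
    ring
  have hlim : Tendsto (fun n : ℕ => T * K * ((K * T) ^ n / n.factorial)) atTop (𝓝 0) := by
    simpa using (FloorSemiring.tendsto_pow_div_factorial_atTop (K * T)).const_mul (T * K)
  obtain ⟨n, hn⟩ := (hlim.eventually (gt_mem_nhds (by norm_num : (0 : ℝ) < 1 / 4))).exists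
  have hcontr : ContractingWith (1 / 2) Γ^[n + 1] := by
    refine ⟨by norm_num, LipschitzWith.of_dist_le_mul fun y y' => ?_⟩
    rw [Subtype.dist_eq, Subtype.dist_eq, dist_eq_norm, dist_eq_norm]
    have h1 := hnorm n y y'
    have h2 : ‖(Γ^[n + 1] y).1 - (Γ^[n + 1] y').1‖ ^ 2 ≤ (1 / 2 * ‖y.1 - y'.1‖) ^ 2 := by
      nlinarith [sq_nonneg ‖y.1 - y'.1‖]
    simpa using (abs_le_of_sq_le_sq' h2 (by positivity)).2
  refine ⟨hcontr.fixedPoint _, hcontr.isFixedPt_fixedPoint_iterate, fun y hy => ?_⟩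
  exact hcontr.fixedPoint_unique (Function.IsFixedPt.iterate hy (n + 1))

/-- The linear stochastic differential equation `y_t = η + ∫_0^t dc y + ∫_0^t D y ds` has exactly one
adapted solution. -/
theorem existsUnique_solution (D : H →L[ℂ] H) (hD : ∀ t, 0 ≤ t → ∀ y ∈ S.past t, D y ∈ S.past t)
    {η : H} (hη : η ∈ S.past 0) {T : ℝ} (hT : 0 ≤ T) :
    ∃! y : S.adaptedSet T, ∀ᵐ t ∂volume.restrict (Set.Icc (0 : ℝ) T),
      S.IsIto t y.1 (y.1 t - η - ∫ r in Set.Icc 0 t, D (y.1 r)) := by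
  choose Γ hΓ hΓ' using fun y : S.adaptedSet T => exists_rhs D hD hη (Lp.memLp y.1) y.2
  have hK : 0 ≤ 2 * (S.const + T * ‖D‖ ^ 2) := by
    have := S.const_nonneg
    positivity
  have hfix : ∀ y : S.adaptedSet T, (∀ᵐ t ∂volume.restrict (Set.Icc (0 : ℝ) T),
      S.IsIto t y.1 (y.1 t - η - ∫ r in Set.Icc 0 t, D (y.1 r))) ↔
        (⟨Γ y, hΓ y⟩ : S.adaptedSet T) = y := fun y => by
    constructor
    · intro h
      refine Subtype.ext (Lp.ext ?_)
      filter_upwards [h, hΓ' y] with t h1 h2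
      simpa [sub_left_inj] using h2.unique h1
    · intro h
      have h2 := hΓ' y
      rwa [show Γ y = y.1 from congrArg Subtype.val h] at h2
  simp only [hfix]
  refine existsUnique_fixedPoint hT hK (fun y => ⟨Γ y, hΓ y⟩) fun y y' => ?_
  filter_upwards [hΓ' y, hΓ' y', ae_restrict_mem measurableSet_Icc] with t h1 h2 ht
  exact norm_rhs_sub_sq_le D ht (Lp.memLp y.1) (Lp.memLp y'.1) h1 h2

end ItoSystem

namespace WhiteNoise

variable {A X : Type*} [CStarAlgebra A] [PartialOrder A] [StarOrderedRing A]
  [NormedAddCommGroup X] [NormedSpace ℂ X] {e : StrongDual ℂ X ≃ₗᵢ[ℂ] A} {τ : TracialState e}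
  {W : WhiteNoise τ} {b : ℝ → L2 τ}

/-! ### Stochastic integrals with respect to a cocycle -/

/-- The increments of the centred part of a cocycle with bounded covariance, as an `ItoSystem`. -/
theorem IsAdditiveCocycle.exists_itoSystem (hb : W.IsAdditiveCocycle b) {k : A}
    (hk : IsCondExpAbsSq τ W.alg₀ (b 1) k) : ∃ S : ItoSystem (L2 τ),
      (∀ t, S.past t = W.adaptedSpace t) ∧ ∀ s t, 0 ≤ s → s ≤ t → ∀ y ∈ W.adaptedSpace s,
        IsMul τ (W.centredPart b t - W.centredPart b s) y (S.incr s t y) := by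
  have hex : ∀ s t, ∃ M : L2 τ →L[ℂ] L2 τ, 0 ≤ s → s ≤ t →
      (∀ y ∈ W.adaptedSpace s, IsMul τ (W.centredPart b t - W.centredPart b s) y (M y)) ∧
      (∀ y, ‖M y‖ ^ 2 ≤ ‖k‖ * (t - s) * ‖y‖ ^ 2) ∧
      (∀ y ∈ W.adaptedSpace s, M y ∈ W.adaptedSpace t) ∧
      ∀ y ∈ W.adaptedSpace s, ∀ w ∈ W.adaptedSpace s, ⟪w, M y⟫_ℂ = 0 := fun s t => by
    by_cases h : 0 ≤ s ∧ s ≤ t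
    · obtain ⟨M, hM⟩ := hb.exists_increment_operator hk h.1 h.2
      exact ⟨M, fun _ _ => hM⟩
    · exact ⟨0, fun h1 h2 => absurd ⟨h1, h2⟩ h⟩
  choose M hM using hex
  refine ⟨{ past := W.adaptedSpace
            isClosed_past := fun t => isClosed_L2Sub τ _
            past_mono := fun s t hs hst => W.adaptedSpace_mono hs hst
            incr := M
            const := ‖k‖
            const_nonneg := norm_nonneg k
            incr_mem := fun s t hs hst => (hM s t hs hst).2.2.1
            norm_incr_sq_le := fun s t hs hst y _ => by
              rw [← mul_assoc]; exact (hM s t hs hst).2.1 y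
            inner_incr := fun s t hs hst => (hM s t hs hst).2.2.2
            incr_add := fun s t u hs hst htu y hy => ?_ },
    fun t => rfl, fun s t hs hst => (hM s t hs hst).1⟩
  refine IsMul.unique ?_ ((hM s u hs (hst.trans htu)).1 y hy)
  have h := ((hM s t hs hst).1 y hy).add_left
    ((hM t u (hs.trans hst) htu).1 y (W.adaptedSpace_mono hs hst hy))
  rwa [add_comm (W.centredPart b t - _), sub_add_sub_cancel] at h

theorem SimpleAdapted.node_mono {t : ℝ} (P : W.SimpleAdapted t) {i j : ℕ} (hij : i ≤ j)
    (hj : j ≤ P.n) : P.node i ≤ P.node j := by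
  induction j, hij using Nat.le_induction with
  | base => exact le_rfl
  | succ k _ ih => exact (ih (by omega)).trans (P.node_lt k (by omega)).le

variable {S : ItoSystem (L2 τ)}

/-- On adapted processes, the Itô integral with respect to the cocycle is that of the associated
`ItoSystem`. -/
theorem hasItoIntegral_iff (hS : ∀ t, S.past t = W.adaptedSpace t)
    (hSM : ∀ s t, 0 ≤ s → s ≤ t → ∀ y ∈ W.adaptedSpace s,
      IsMul τ (W.centredPart b t - W.centredPart b s) y (S.incr s t y))
    {t : ℝ} (ht : 0 ≤ t) {y : ℝ → L2 τ} (hy : MemLp y 2 (volume.restrict (Set.Icc 0 t)))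
    (had : ∀ᵐ r ∂volume.restrict (Set.Icc 0 t), y r ∈ W.adaptedSpace r) {J : L2 τ} :
    W.HasItoIntegral (W.centredPart b) t y J ↔ S.IsIto t y J := by
  have himp : ∀ J, W.HasItoIntegral (W.centredPart b) t y J → S.IsIto t y J := by
    rintro J ⟨P, I, hI, hP, hlim⟩
    have h0 : ∀ m, ∀ k < (P m).n, 0 ≤ (P m).node k := fun m k hk => by
      rw [← (P m).node_zero]; exact (P m).node_mono k.zero_le hk.le
    have hle : ∀ m, ∀ k < (P m).n, (P m).node k ≤ (P m).node (k + 1) := fun m k hk =>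
      ((P m).node_lt k hk).le
    refine ItoSystem.isIto_of_tendsto hy (u := fun m => (P m).node) (n := fun m => (P m).n)
      (v := fun m => (P m).value) (fun m k hk => ⟨h0 m k hk, hle m k hk, ?_⟩)
      (fun m k hk => by rw [hS]; exact (P m).value_mem k hk) hP (hlim.congr fun m => ?_)
    · exact ((P m).node_mono hk le_rfl).trans (P m).node_last.le
    · obtain ⟨z, hz, hzI⟩ := hI m
      rw [hzI]
      refine Finset.sum_congr rfl fun k hk => ?_
      have hk' := Finset.mem_range.1 hk
      exact (hz k hk').unique (hSM _ _ (h0 m k hk') (hle m k hk') _ ((P m).value_mem k hk'))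
  refine ⟨himp J, fun hJ => ?_⟩
  -- The integral exists by approximation, and the other implication identifies its value.
  suffices h : ∃ I, W.HasItoIntegral (W.centredPart b) t y I by
    obtain ⟨I, hI⟩ := h
    rwa [hJ.unique (himp I hI)]
  rcases ht.eq_or_lt with rfl | ht
  · refine ⟨0, fun _ => ⟨0, fun _ => 0, rfl, rfl, by simp, fun _ => 0, by simp⟩, fun _ => 0,
      fun m => ⟨fun _ => 0, by simp, by simp⟩, by simp, tendsto_const_nhds⟩
  · obtain ⟨v, I, hv, hlim, hI, -, -⟩ := ItoSystem.exists_ito_approx (S := S) ht hy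
      (had.mono fun r hr => by rwa [hS])
    have hh : ∀ m : ℕ, 0 < t / ((m : ℝ) + 1) := fun m => by positivity
    have hlt : ∀ m k : ℕ, (k : ℝ) * (t / ((m : ℝ) + 1))
        < ((k + 1 : ℕ) : ℝ) * (t / ((m : ℝ) + 1)) := fun m k =>
      mul_lt_mul_of_pos_right (by exact_mod_cast k.lt_succ_self) (hh m)
    refine ⟨I, fun m =>
      { n := m + 1
        node := fun k => k * (t / (m + 1))
        node_zero := by simp
        node_last := by push_cast; field_simp
        node_lt := fun k _ => hlt m k
        value := v m
        value_mem := fun k _ => by rw [← hS]; exact hv m k }, _, fun m =>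
      ⟨fun k => S.incr (k * (t / (m + 1))) ((k + 1 : ℕ) * (t / (m + 1))) (v m k),
        fun k _ => ?_, rfl⟩, hlim, hI⟩
    exact hSM _ _ (mul_nonneg k.cast_nonneg (hh m).le) (hlt m k).le _ (by rw [← hS]; exact hv m k)

/-- With the drift `D` given as a bounded operator, the equation `x = ∫_0^t db y` becomes an equation
for the Itô integral. -/
theorem hasStochasticIntegral_iff (hS : ∀ t, S.past t = W.adaptedSpace t)
    (hSM : ∀ s t, 0 ≤ s → s ≤ t → ∀ y ∈ W.adaptedSpace s,
      IsMul τ (W.centredPart b t - W.centredPart b s) y (S.incr s t y))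
    {D : L2 τ →L[ℂ] L2 τ} (hD : ∀ t, 0 ≤ t → ∀ y ∈ W.adaptedSpace t,
      IsMul τ (W.driftCoeff b) y (D y) ∧ D y ∈ W.adaptedSpace t)
    {t : ℝ} (ht : 0 ≤ t) {y : ℝ → L2 τ} (hy : MemLp y 2 (volume.restrict (Set.Icc 0 t)))
    (had : ∀ᵐ r ∂volume.restrict (Set.Icc 0 t), y r ∈ W.adaptedSpace r) {x : L2 τ} :
    W.HasStochasticIntegral b t y x ↔ S.IsIto t y (x - ∫ r in Set.Icc 0 t, D (y r)) := by
  have hmul : ∀ᵐ r ∂volume.restrict (Set.Icc 0 t), IsMul τ (W.driftCoeff b) (y r) (D (y r)) := by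
    filter_upwards [had, ae_restrict_mem measurableSet_Icc] with r hr hr'
    exact (hD r hr'.1 _ hr).1
  constructor
  · rintro ⟨J, g, hJ, -, hg, rfl⟩
    have hgD : ∫ r in Set.Icc 0 t, g r = ∫ r in Set.Icc 0 t, D (y r) :=
      integral_congr_ae (by filter_upwards [hg, hmul] with r h1 h2 using h1.unique h2)
    rw [hgD, add_sub_cancel_right]
    exact (hasItoIntegral_iff hS hSM ht hy had).1 hJ
  · intro h
    exact ⟨_, fun r => D (y r), (hasItoIntegral_iff hS hSM ht hy had).2 h,
      D.integrable_comp (hy.integrable one_le_two), hmul, (sub_add_cancel _ _).symm⟩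

end WhiteNoise

end NCWhiteNoise

theorem mainTheorem5 {A X : Type*} [CStarAlgebra A] [PartialOrder A] [StarOrderedRing A]
    [NormedAddCommGroup X] [NormedSpace ℂ X] [CompleteSpace X] [TopologicalSpace.SeparableSpace X]
    (e : StrongDual ℂ X ≃ₗᵢ[ℂ] A) (τ : NCWhiteNoise.TracialState e)
    (W : NCWhiteNoise.WhiteNoise τ) (b : ℝ → NCWhiteNoise.L2 τ)
    (hb : W.IsAdditiveCocycle b) (hcov : W.HasBoundedCovariance b) (T : ℝ) (hT : 0 ≤ T) :
    ∃! y : W.adaptedProcesses T, W.IsSolution b T y := by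
  obtain ⟨k, hk⟩ := hcov
  obtain ⟨S, hS, hSM⟩ := hb.exists_itoSystem hk
  obtain ⟨D, hD⟩ := NCWhiteNoise.WhiteNoise.exists_drift_operator hk
  have hη : NCWhiteNoise.toL2 τ 1 ∈ S.past 0 := by
    rw [hS]
    exact NCWhiteNoise.toL2_mem_L2Sub τ (one_mem _)
  have hset : ∀ y, y ∈ S.adaptedSet T ↔ y ∈ W.adaptedProcesses T := fun y => by
    rw [NCWhiteNoise.ItoSystem.adaptedSet, Set.mem_ofPred]
    simp only [hS]
    rfl
  have hsol : ∀ (y) (hy : y ∈ W.adaptedProcesses T), W.IsSolution b T ⟨y, hy⟩ ↔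
      ∀ᵐ t ∂volume.restrict (Set.Icc (0 : ℝ) T),
        S.IsIto t y (y t - NCWhiteNoise.toL2 τ 1 - ∫ r in Set.Icc 0 t, D (y r)) := fun y hy => by
    have hiff : ∀ t ∈ Set.Icc 0 T, W.HasStochasticIntegral b t y (y t - NCWhiteNoise.toL2 τ 1) ↔
        S.IsIto t y (y t - NCWhiteNoise.toL2 τ 1 - ∫ r in Set.Icc 0 t, D (y r)) := fun t ht =>
      NCWhiteNoise.WhiteNoise.hasStochasticIntegral_iff hS hSM hD ht.1
        ((Lp.memLp y).mono_measure (NCWhiteNoise.ItoSystem.restrict_Icc_le ht.2))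
        (ae_mono (NCWhiteNoise.ItoSystem.restrict_Icc_le ht.2) hy)
    exact Filter.eventually_congr (by
      filter_upwards [ae_restrict_mem measurableSet_Icc] with t ht using hiff t ht)
  obtain ⟨y, hy, huniq⟩ := NCWhiteNoise.ItoSystem.existsUnique_solution (S := S) D
    (fun t ht y hy => by rw [hS] at hy ⊢; exact (hD t ht y hy).2) hη hT
  refine ⟨⟨y.1, (hset _).1 y.2⟩, (hsol _ _).2 hy, fun z hz => Subtype.ext ?_⟩
  have h : z.1 = y.1 := Subtype.ext_iff.1 (huniq ⟨z.1, (hset _).2 z.2⟩ ((hsol _ z.2).1 hz))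
  exact h
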